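/- **Setting.** Let $f:\mathbb R^d\to\mathbb R$ ($d\ge 1$) be differentiable and $L$-smooth, $\|\nabla f(x)-\nabla f(y)\|\le L\|x-y\|$ for all $x,y$, with $f\ge f^*$ for some $f^*\in\mathbb R$. Let $x^0\in\mathbb R^d$ and $\Delta=f(x^0)-f^*$. Assume that, for constants $L_A,L_B\ge 0$, $$\Big\|\tfrac1N\sum_{i=1}^N(\nabla f(x+u_i)-\nabla f(x))\Big\|^2\le L_A^2\,\tfrac1N\sum_{i=1}^N\|u_i\|^2+L_B^2\Big\|\tfrac1N\sum_{i=1}^N u_i\Big\|^2$$ for all $N\ge1$ and $x,u_1,\dots,u_N\in\mathbb R^d$. Put $L_{\max}=\max\{L,L_A,L_B\}$. The workers have access to stochastic gradients $\nabla f(x;\xi)$ with $\mathbb E_\xi[\nabla f(x;\xi)]=\nabla f(x)$ and $\mathbb E_\xi\|\nabla f(x;\xi)-\nabla f(x)\|^2\le\sigma^2$ for all $x$, where $\sigma>0$. Let $\varepsilon>0$. There are $n\ge1$ workers. Worker $i$ computes a stochastic gradient in at most $h_i$ seconds, sends one coordinate to the server in at most $\tau_i$ seconds, and receives one coordinate from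 the server in at most $\kappa_i$ seconds ($h_i,\tau_i,\kappa_i>0$). Put $\kappa_{\max}=\max_i\kappa_i$ and $\omega=\omega_{\rm s}=d-1$. **Method (Heterogeneous-Time Inkheart SGD with Rand1).** Given $b_i,m_i,\ell_i\in\mathbb N$, $p\in(0,1]$, a step size $\gamma$ and weights $\beta_i$, start with $x_i^0=x^0$ for all $i$ and iterate, for $k=0,1,\dots$, $$g^k=\sum_{i=1}^n\frac{\beta_i}{b_im_i}\sum_{j=1}^{m_i}\mathcal C^k_{ij}\Big(\sum_{r=1}^{b_i}\nabla f(x_i^k;\xi_{ir}^k)\Big),\qquad x^{k+1}=x^k-\gamma g^k,\qquad c^k\sim\mathrm{Bernoulli}(p),$$ $$x_i^{k+1}=x^{k+1}\ \text{ if } c^k=1,\qquad x_i^{k+1}=x_i^k+\frac1{\ell_i}\sum_{j=1}^{\ell_i}\mathcal C^k_{{\rm s},ij}(x^{k+1}-x^k)\ \text{ if } c^k=0 .$$ All $\mathcal C^k_{ij},\mathcal C^k_{{\rm s},ij}$ are Rand1 compressors ($x\mapsto d\,x_Je_J$ with $J$ uniform on $\{1,\dots,d\}$), and all samples, compressors and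 coins are independent. An iteration takes the time in which all workers compute their $b_i$ gradients in parallel, plus the time in which all of them send $m_i$ coordinates in parallel, plus the time in which the server sends to all workers in parallel $d$ coordinates (if $c^k=1$) or $\ell_i$ coordinates (if $c^k=0$). **Parameters.** Let $s^*>0$ be the solution of $$\left(\sum_{i=1}^n\frac1{\frac{16\omega\tau_i}{s}+\frac{16\sigma^2h_i}{\varepsilon s}+\frac{32\sigma^2\omega h_i\tau_i}{\varepsilon s^2}+\frac{4d\omega_{\rm s}\kappa_{\max}\kappa_i}{s^2}+\frac{8d\omega_{\rm s}\omega\kappa_{\max}\kappa_i\tau_i}{s^3}}\right)^{-1}=1,$$ let $t=\max\{\max_i\{h_i,\tau_i,\kappa_i\},s^*\}$, $b_i=\lfloor t/h_i\rfloor$, $m_i=\lfloor t/\tau_i\rfloor$, $\ell_i=\lfloor t/\kappa_i\rfloor$, $p=\min\{\lfloor t/\kappa_{\max}\rfloor/d,\,1\}$, $$\beta_i=\frac{w_i}{\sum_jw_j},\qquad w_i=\left(\frac{8\omega}{m_i}+\frac{8\sigma^2\omega}{\varepsilon b_im_i}+\frac{8\sigma^2}{\varepsilon b_i}+\frac{\omega_{\rm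 s}\omega}{pm_i\ell_i}+\frac{\omega_{\rm s}}{p\ell_i}\right)^{-1},$$ $$M=\max\left\{L_{\max},\ L_{\max}\sqrt{\sum_{i}\Big(\frac{\omega\omega_{\rm s}}{pm_i\ell_i}+\frac{\omega_{\rm s}}{p\ell_i}\Big)\beta_i^2},\ L_A\sqrt{\frac1p\sum_i\frac{\omega_{\rm s}\beta_i}{\ell_i}}\right\},\qquad \gamma=\frac1{6M},\qquad N=\Big\lfloor\frac{48\,\Delta M}{\varepsilon}\Big\rfloor$$ (with $\gamma=0$ in the trivial case $M=0$, in which $f$ is constant). **Theorem (Time Complexity of Heterogeneous-Time Inkheart SGD).** The equation above has exactly one solution $s^*>0$. The method finds an $\varepsilon$-stationary point in $N$ iterations: if $\bar x$ is chosen uniformly at random, independently of everything else, among $x^0,\dots,x^N$, then $\mathbb E\|\nabla f(\bar x)\|^2\le\varepsilon$. The expected total time of these $N$ iterations is finite and at most $$C\left(\frac{t\,L_{\max}\Delta}{\varepsilon}+\frac{d\,\kappa_{\max}L_A\Delta}{\varepsilon}\right),$$ where $C>0$ is a universal constant. -/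

import Mathlib

open MeasureTheory ProbabilityTheory

noncomputable section

namespace Inkheart

/-- The Euclidean space `ℝ^d`. -/
abbrev Vec (d : ℕ) := EuclideanSpace ℝ (Fin d)

/-! ### Assumptions on the optimization problem -/

/-- `f` is differentiable with `L`-Lipschitz gradient. -/
def IsLSmooth {d : ℕ} (f : Vec d → ℝ) (L : ℝ) : Prop :=
  Differentiable ℝ f ∧ ∀ x y, ‖gradient f x - gradient f y‖ ≤ L * ‖x - y‖

/-- `G x ξ`, with `ξ` drawn from the distribution `D`, is an unbiased stochastic gradient of `f`
with `σ²`-bounded variance. -/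
def IsStochasticGradient {d : ℕ} {Ξ : Type*} [MeasurableSpace Ξ] (f : Vec d → ℝ)
    (G : Vec d → Ξ → Vec d) (D : Measure Ξ) (σ : ℝ) : Prop :=
  Measurable (fun q : Vec d × Ξ => G q.1 q.2) ∧
  ∀ x, Integrable (G x) D ∧ ∫ ξ, G x ξ ∂D = gradient f x ∧
    Integrable (fun ξ => ‖G x ξ - gradient f x‖ ^ 2) D ∧
    ∫ ξ, ‖G x ξ - gradient f x‖ ^ 2 ∂D ≤ σ ^ 2

/-- The functional `(L_A, L_B)` inequality; the number `N` of displacements is arbitrary. -/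
def FunctionalAB {d : ℕ} (f : Vec d → ℝ) (LA LB : ℝ) : Prop :=
  0 ≤ LA ∧ 0 ≤ LB ∧ ∀ N : ℕ, 1 ≤ N → ∀ (x : Vec d) (u : Fin N → Vec d),
    ‖(1 / (N : ℝ)) • ∑ i, (gradient f (x + u i) - gradient f x)‖ ^ 2 ≤
      LA ^ 2 * ((1 / (N : ℝ)) * ∑ i, ‖u i‖ ^ 2) + LB ^ 2 * ‖(1 / (N : ℝ)) • ∑ i, u i‖ ^ 2

/-- A random point `X` on the probability space `(Ω, μ)` is `ε`-stationary for `f`: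
`E‖∇f(X)‖² ≤ ε`. -/
def IsStationaryPoint {d : ℕ} {Ω : Type*} [MeasurableSpace Ω] (f : Vec d → ℝ) (ε : ℝ)
    (μ : Measure Ω) (X : Ω → Vec d) : Prop :=
  Measurable X ∧ Integrable (fun ω => ‖gradient f (X ω)‖ ^ 2) μ ∧
    ∫ ω, ‖gradient f (X ω)‖ ^ 2 ∂μ ≤ ε

/-! ### The method -/

/-- The parameters of the method: batch sizes `b i`, numbers `m i` and `l i` of compressed vectors
sent by and to worker `i`, synchronization probability `p`, step size `γ`, weights `β i`. -/
structure Hyper (n : ℕ) where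
  b : Fin n → ℕ
  m : Fin n → ℕ
  l : Fin n → ℕ
  p : ℝ
  γ : ℝ
  β : Fin n → ℝ

/-- The Rand1 compressor when coordinate `j` is drawn: `x ↦ d * x_j * e_j`. -/
def rand1 {d : ℕ} (j : Fin d) (x : Vec d) : Vec d :=
  ((d : ℝ) * x j) • EuclideanSpace.single j (1 : ℝ)

/-- The distribution of a coin equal to `true` with probability `p`. -/
def coinLaw (p : ℝ) : Measure Bool :=
  ENNReal.ofReal p • Measure.dirac true + ENNReal.ofReal (1 - p) • Measure.dirac false

/-- The random draws of one iteration: the samples `ξ_{ir}`, the coordinates drawn by the Rand1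
compressors of the workers and of the server, and the coin. -/
abbrev Noise {n : ℕ} (H : Hyper n) (d : ℕ) (Ξ : Type*) :=
  ((i : Fin n) → Fin (H.b i) → Ξ) × ((i : Fin n) → Fin (H.m i) → Fin d) ×
    ((i : Fin n) → Fin (H.l i) → Fin d) × Bool

/-- The law of the draws of one iteration: all of them are independent, the samples have law `D`,
the coordinates are uniform and the coin is Bernoulli(`p`). -/
def noiseLaw {n : ℕ} (H : Hyper n) (d : ℕ) {Ξ : Type*} [MeasurableSpace Ξ] (D : Measure Ξ) :
    Measure (Noise H d Ξ) :=
  (Measure.pi fun i : Fin n => Measure.pi fun _ : Fin (H.b i) => D).prod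
    ((Measure.pi fun i : Fin n => Measure.pi fun _ : Fin (H.m i) =>
        uniformOn (Set.univ : Set (Fin d))).prod
      ((Measure.pi fun i : Fin n => Measure.pi fun _ : Fin (H.l i) =>
          uniformOn (Set.univ : Set (Fin d))).prod
        (coinLaw H.p)))

/-- `ζ 0, ζ 1, …` are the draws of the successive iterations on the probability space `(Ω, P)`. -/
def IsNoiseSequence {n d : ℕ} {Ξ Ω : Type*} [MeasurableSpace Ξ] [MeasurableSpace Ω]
    (H : Hyper n) (D : Measure Ξ) (P : Measure Ω) (ζ : ℕ → Ω → Noise H d Ξ) : Prop :=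
  (∀ k, Measurable (ζ k)) ∧ (∀ k, P.map (ζ k) = noiseLaw H d D) ∧ iIndepFun ζ P

/-- The aggregated gradient estimator `g`, when worker `i` is at the point `y i`. -/
def gradEstimator {n d : ℕ} {Ξ : Type*} (H : Hyper n) (G : Vec d → Ξ → Vec d)
    (y : Fin n → Vec d) (z : Noise H d Ξ) : Vec d :=
  ∑ i, (H.β i / ((H.b i : ℝ) * (H.m i : ℝ))) •
    ∑ j : Fin (H.m i), rand1 (z.2.1 i j) (∑ r : Fin (H.b i), G (y i) (z.1 i r))

/-- One iteration, from (server point, worker points) to (server point, worker points). -/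
def step {n d : ℕ} {Ξ : Type*} (H : Hyper n) (G : Vec d → Ξ → Vec d)
    (S : Vec d × (Fin n → Vec d)) (z : Noise H d Ξ) : Vec d × (Fin n → Vec d) :=
  let x' := S.1 - H.γ • gradEstimator H G S.2 z
  (x', fun i =>
    if z.2.2.2 = true then x'
    else S.2 i + (1 / (H.l i : ℝ)) • ∑ j : Fin (H.l i), rand1 (z.2.2.1 i j) (x' - S.1))

/-- The iterates, started with the server and all workers at `x0`. -/
def iterates {n d : ℕ} {Ξ Ω : Type*} (H : Hyper n) (G : Vec d → Ξ → Vec d) (x0 : Vec d)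
    (ζ : ℕ → Ω → Noise H d Ξ) : ℕ → Ω → Vec d × (Fin n → Vec d)
  | 0, _ => (x0, fun _ => x0)
  | k + 1, ω => step H G (iterates H G x0 ζ k ω) (ζ k ω)

/-- The output after `N` iterations: a uniformly random one of the server points
`x^0, …, x^N`, on the space `Ω × {0, …, N}`. -/
def output {n d : ℕ} {Ξ Ω : Type*} (H : Hyper n) (G : Vec d → Ξ → Vec d) (x0 : Vec d)
    (ζ : ℕ → Ω → Noise H d Ξ) (N : ℕ) (q : Ω × Fin (N + 1)) : Vec d :=
  (iterates H G x0 ζ q.2 q.1).1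

/-! ### The time model -/

/-- The actual, possibly random, durations. In iteration `k`, worker `i` needs `comp k i r` seconds
for its `r`-th stochastic gradient, `up k i j` seconds to send its `j`-th coordinate to the
server, and receiving the `q`-th coordinate from the server takes `down k i q` seconds. They are
at most `h i`, `τ i`, `κ i`. -/
structure Durations {n : ℕ} (h τ κ : Fin n → ℝ) (Ω : Type*) [MeasurableSpace Ω] where
  comp : ℕ → Fin n → ℕ → Ω → ℝ
  up : ℕ → Fin n → ℕ → Ω → ℝ
  down : ℕ → Fin n → ℕ → Ω → ℝ
  measurable_comp : ∀ k i r, Measurable (comp k i r)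
  measurable_up : ∀ k i j, Measurable (up k i j)
  measurable_down : ∀ k i q, Measurable (down k i q)
  comp_mem : ∀ k i r ω, comp k i r ω ∈ Set.Icc 0 (h i)
  up_mem : ∀ k i j ω, up k i j ω ∈ Set.Icc 0 (τ i)
  down_mem : ∀ k i q ω, down k i q ω ∈ Set.Icc 0 (κ i)

/-- The duration of iteration `k`. The workers compute in parallel, then send their compressed
vectors (one coordinate each) in parallel, then the server sends to all workers in parallel
either all `d` coordinates or `l i` compressed vectors of one coordinate each; every phase
lasts until the slowest worker is done. -/
def iterationTime {n d : ℕ} {Ξ Ω : Type*} [MeasurableSpace Ω] {h τ κ : Fin n → ℝ} (H : Hyper n)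
    (T : Durations h τ κ Ω) (ζ : ℕ → Ω → Noise H d Ξ) (k : ℕ) (ω : Ω) : ℝ :=
  (⨆ i, ∑ r ∈ Finset.range (H.b i), T.comp k i r ω) +
  (⨆ i, ∑ j ∈ Finset.range (H.m i), T.up k i j ω) +
  (⨆ i, ∑ q ∈ Finset.range (if (ζ k ω).2.2.2 = true then d else H.l i), T.down k i q ω)

/-- The duration of the first `N` iterations. -/
def totalTime {n d : ℕ} {Ξ Ω : Type*} [MeasurableSpace Ω] {h τ κ : Fin n → ℝ} (H : Hyper n)
    (T : Durations h τ κ Ω) (ζ : ℕ → Ω → Noise H d Ξ) (N : ℕ) (ω : Ω) : ℝ :=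
  ∑ k ∈ Finset.range N, iterationTime H T ζ k ω

/-! ### The choice of the parameters

Below `ω` and `ωs` are the variance parameters of the compressors of the workers and of the
server. -/

/-- `κ_max`. -/
def kappaMax {n : ℕ} (κ : Fin n → ℝ) : ℝ := ⨆ i, κ i

/-- `s` solves the equilibrium equation. -/
def IsEquilibriumTime {n : ℕ} (d : ℕ) (ω ωs σ ε : ℝ) (h τ κ : Fin n → ℝ) (s : ℝ) : Prop :=
  0 < s ∧
  (∑ i, 1 / (16 * ω * τ i / s + 16 * σ ^ 2 * h i / (ε * s)
      + 32 * σ ^ 2 * ω * h i * τ i / (ε * s ^ 2)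
      + 4 * d * ωs * kappaMax κ * κ i / s ^ 2
      + 8 * d * ωs * ω * kappaMax κ * κ i * τ i / s ^ 3))⁻¹ = 1

/-- The time budget `t = max {max_i {h_i, τ_i, κ_i}, s}`. -/
def timeBudget {n : ℕ} (h τ κ : Fin n → ℝ) (s : ℝ) : ℝ :=
  max (⨆ i, max (h i) (max (τ i) (κ i))) s

/-- The synchronization probability `min {⌊t / κ_max⌋ / d, 1}`. -/
def syncProb {n : ℕ} (d : ℕ) (κ : Fin n → ℝ) (t : ℝ) : ℝ :=
  min ((⌊t / kappaMax κ⌋₊ : ℝ) / d) 1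

/-- The unnormalized weight `w_i` of a worker with parameters `b`, `m`, `l`. -/
def rawWeight (ω ωs σ ε p : ℝ) (b m l : ℕ) : ℝ :=
  (8 * ω / m + 8 * σ ^ 2 * ω / (ε * b * m) + 8 * σ ^ 2 / (ε * b)
    + ωs * ω / (p * m * l) + ωs / (p * l))⁻¹

/-- The weights `β_i = w_i / ∑_j w_j`. -/
def optWeights {n : ℕ} (ω ωs σ ε p : ℝ) (b m l : Fin n → ℕ) (i : Fin n) : ℝ :=
  rawWeight ω ωs σ ε p (b i) (m i) (l i) / ∑ j, rawWeight ω ωs σ ε p (b j) (m j) (l j)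

/-- The effective smoothness constant
`max {L_max, L_max √(∑ (ω ωs / (p m_i l_i) + ωs / (p l_i)) β_i²), L_A √(p⁻¹ ∑ ωs β_i / l_i)}`. -/
def effSmoothness {n : ℕ} (ω ωs Lmax LA p : ℝ) (m l : Fin n → ℕ) (β : Fin n → ℝ) : ℝ :=
  max Lmax (max
    (Lmax * √(∑ i, (ω * ωs / (p * m i * l i) + ωs / (p * l i)) * β i ^ 2))
    (LA * √(1 / p * ∑ i, ωs * β i / l i)))

/-- The parameters of the method for the time budget `t`; the step size is
`1 / (6 * effSmoothness)`. -/
def budgetHyper {n : ℕ} (d : ℕ) (ω ωs σ ε Lmax LA : ℝ) (h τ κ : Fin n → ℝ) (t : ℝ) : Hyper n :=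
  let b : Fin n → ℕ := fun i => ⌊t / h i⌋₊
  let m : Fin n → ℕ := fun i => ⌊t / τ i⌋₊
  let l : Fin n → ℕ := fun i => ⌊t / κ i⌋₊
  let p := syncProb d κ t
  let β := optWeights ω ωs σ ε p b m l
  { b := b, m := m, l := l, p := p, β := β,
    γ := 1 / (6 * effSmoothness ω ωs Lmax LA p m l β) }

/-- The number of iterations, `48 * Δ / ε` times the effective smoothness constant, rounded
down; so at least that many points `x^0, …, x^N` are available after `N` iterations. -/
def numIterations {n : ℕ} (H : Hyper n) (ω ωs Lmax LA Δ ε : ℝ) : ℕ :=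
  ⌊48 * (Δ / ε) * effSmoothness ω ωs Lmax LA H.p H.m H.l H.β⌋₊

end Inkheart

end

/-! The convergence half is a Lyapunov argument. To `f x - fstar` one adds `γ / (2p)` times
`spread`, which collects three squared measures of the distance of the workers from the server: the
weighted mean of squares, the square of the weighted mean, and the sum that enters through the
compression variance. Expanding `f` quadratically along the step leaves the inner product of `∇f(x)`
with the mean estimator. By polarization and the weighted `(L_A, L_B)` inequality (`neg_inner_le`)
it costs half of the first two parts of `spread` and gains half of both squared norms. The estimator
is unbiased, and its variance is controlled by `‖∇f(x)‖²`, the third part of `spread`, and a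
multiple of `ε` (`varEstimator_le`). A synchronization kills `spread`. Otherwise the server's
unbiased compression preserves the mean displacements and adds only variance, so `spread` contracts
by `1 - p` up to a term of order `p M² γ²` times the second moment of the estimator
(`integral_spread_step`). With `γ = 1 / (6M)` everything is absorbed (`integral_lyapunov_step`), and
telescoping bounds the average squared gradient.

The other half shows that the parameters are admissible and that `M` is small. Each worker has an
inverse weight `1 / w_i` that dominates all its contributions to the variance. With `β_i = w_i / W`,
where `W = ∑ w_j`, a sum `∑ β_i² c_i` with `c_i ≤ r / w_i` is at most `r / W`, so all that is needed
is a lower bound for `W`. Rounding `t / a` down loses at most a factor 2, and the denominators of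
the equilibrium equation are the inverse weights with these losses inserted. They decrease in `s`,
so for `t ≥ s*` the sum of their reciprocals is at least 1. This gives `W ≥ 1` as long as `1/p` is
of order `d κ_max / t`. If `p` is truncated at 1, the server's compression is harmless and still `W
≥ 8/17` (`IsBudget.sum_weight_ge`). An iteration lasts at most `4t` on average, because `p d κ_max ≤
t`, and `M t ≤ 2 t L_max + 2 d κ_max L_A` (`smoothness_mul_le`). -/

noncomputable section

namespace Inkheart

/-! ### Square-integrable random vectors -/

section SqMean

set_option linter.unusedSectionVars false

variable {α β E : Type*} [MeasurableSpace α] [MeasurableSpace β] [NormedAddCommGroup E]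
  [InnerProductSpace ℝ E] [MeasurableSpace E] [BorelSpace E] [SecondCountableTopology E]

/-- `φ` has mean `m`, and `E‖φ - m‖² ≤ v`. -/
structure SqMean (μ : Measure α) (φ : α → E) (m : E) (v : ℝ) : Prop where
  meas : Measurable φ
  int : Integrable (fun a => ‖φ a‖ ^ 2) μ
  mean : ∫ a, φ a ∂μ = m
  sq : ∫ a, ‖φ a‖ ^ 2 ∂μ ≤ ‖m‖ ^ 2 + v

/-- `φ` is square integrable with `E‖φ‖² ≤ w`. -/
structure SqBound (μ : Measure α) (φ : α → E) (w : ℝ) : Prop where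
  meas : Measurable φ
  int : Integrable (fun a => ‖φ a‖ ^ 2) μ
  sq : ∫ a, ‖φ a‖ ^ 2 ∂μ ≤ w

lemma integrable_of_sq {μ : Measure α} [IsFiniteMeasure μ] {φ : α → E} (hm : Measurable φ)
    (hi : Integrable (fun a => ‖φ a‖ ^ 2) μ) : Integrable φ μ :=
  ((memLp_two_iff_integrable_sq_norm hm.aestronglyMeasurable).2 hi).integrable one_le_two

lemma integrable_inner_of_sq {μ : Measure α} {φ ψ : α → E} (hφ : Measurable φ)
    (hψ : Measurable ψ) (hi : Integrable (fun a => ‖φ a‖ ^ 2) μ)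
    (hj : Integrable (fun a => ‖ψ a‖ ^ 2) μ) : Integrable (fun a => inner ℝ (φ a) (ψ a)) μ := by
  refine (hi.add hj).mono' (hφ.inner hψ).aestronglyMeasurable (ae_of_all _ fun a => ?_)
  have h1 := norm_inner_le_norm (𝕜 := ℝ) (φ a) (ψ a)
  simp only [Pi.add_apply]
  nlinarith [sq_nonneg (‖φ a‖ - ‖ψ a‖), sq_nonneg (‖φ a‖), sq_nonneg (‖ψ a‖)]

lemma integrable_sq_sum {ι : Type*} [Fintype ι] {μ : Measure α} {φ : ι → α → E}
    (hφ : ∀ i, Measurable (φ i)) (hi : ∀ i, Integrable (fun a => ‖φ i a‖ ^ 2) μ) :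
    Integrable (fun a => ‖∑ i, φ i a‖ ^ 2) μ := by
  have : (fun a => ‖∑ i, φ i a‖ ^ 2) = fun a => ∑ i, ∑ j, inner ℝ (φ i a) (φ j a) := by
    funext a
    rw [← real_inner_self_eq_norm_sq, sum_inner]
    simp_rw [inner_sum]
  rw [this]
  exact integrable_finsetSum _ fun i _ => integrable_finsetSum _ fun j _ =>
    integrable_inner_of_sq (hφ i) (hφ j) (hi i) (hi j)

lemma SqMean.bound {μ : Measure α} {φ : α → E} {m : E} {v : ℝ} (h : SqMean μ φ m v) :
    SqBound μ φ (‖m‖ ^ 2 + v) := ⟨h.meas, h.int, h.sq⟩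

lemma SqMean.smul {μ : Measure α} {φ : α → E} {m : E} {v : ℝ} (h : SqMean μ φ m v) (c : ℝ) :
    SqMean μ (fun a => c • φ a) (c • m) (c ^ 2 * v) where
  meas := h.meas.const_smul c
  int := by
    simp only [norm_smul, mul_pow]
    exact h.int.const_mul _
  mean := by rw [integral_smul, h.mean]
  sq := by
    simp only [norm_smul, mul_pow, Real.norm_eq_abs, sq_abs]
    rw [integral_const_mul]
    nlinarith [h.sq, sq_nonneg c]

lemma SqMean.mono {μ : Measure α} {φ : α → E} {m : E} {v w : ℝ} (h : SqMean μ φ m v)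
    (hvw : v ≤ w) : SqMean μ φ m w := ⟨h.meas, h.int, h.mean, h.sq.trans (by gcongr)⟩

/-- The cross term `2⟪u, φ⟫` sees only the mean of `φ`, so a translation leaves the variance bound
unchanged. -/
lemma SqMean.const_add [CompleteSpace E] {μ : Measure α} [IsProbabilityMeasure μ] {φ : α → E}
    {m : E} {v : ℝ} (h : SqMean μ φ m v) (u : E) : SqMean μ (fun a => u + φ a) (u + m) v := by
  have hφ := integrable_of_sq h.meas h.int
  have e : (fun a => ‖u + φ a‖ ^ 2) = fun a => ‖u‖ ^ 2 + 2 * inner ℝ u (φ a) + ‖φ a‖ ^ 2 := by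
    funext a
    rw [norm_add_sq_real]
  have hin : Integrable (fun a => 2 * inner ℝ u (φ a)) μ := (hφ.const_inner u).const_mul 2
  have hc : Integrable (fun a => ‖u‖ ^ 2 + 2 * inner ℝ u (φ a)) μ :=
    (integrable_const _).add hin
  refine ⟨h.meas.const_add u, by rw [e]; exact hc.add h.int, ?_, ?_⟩
  · rw [integral_add (integrable_const _) hφ, h.mean]
    simp
  · rw [e, integral_add hc h.int, integral_add (integrable_const _) hin, integral_const_mul,
      integral_inner hφ, h.mean, norm_add_sq_real]
    simp only [integral_const, probReal_univ, smul_eq_mul, one_mul]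
    linarith [h.sq]

lemma SqMean.comp {μ : Measure α} {ν : Measure β} {φ : β → E} {m : E} {v : ℝ}
    (h : SqMean ν φ m v) {e : α → β} (he : MeasurePreserving e μ ν) :
    SqMean μ (fun a => φ (e a)) m v where
  meas := h.meas.comp he.measurable
  int := he.integrable_comp_of_integrable h.int
  mean := by
    rw [← h.mean, ← he.map_eq, integral_map he.measurable.aemeasurable
      h.meas.aestronglyMeasurable]
  sq := by
    rw [← integral_map (f := fun b => ‖φ b‖ ^ 2) he.measurable.aemeasurable
      (h.meas.norm.pow_const 2).aestronglyMeasurable, he.map_eq]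
    exact h.sq

lemma SqBound.comp {μ : Measure α} {ν : Measure β} {φ : β → E} {w : ℝ}
    (h : SqBound ν φ w) {e : α → β} (he : MeasurePreserving e μ ν) :
    SqBound μ (fun a => φ (e a)) w where
  meas := h.meas.comp he.measurable
  int := he.integrable_comp_of_integrable h.int
  sq := by
    rw [← integral_map (f := fun b => ‖φ b‖ ^ 2) he.measurable.aemeasurable
      (h.meas.norm.pow_const 2).aestronglyMeasurable, he.map_eq]
    exact h.sq

lemma SqBound.prod {μ : Measure α} {ν : Measure β} [IsProbabilityMeasure μ]
    [IsProbabilityMeasure ν] {F : α × β → E} {B : α → ℝ} {w : ℝ} (hF : Measurable F)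
    (h : ∀ a, SqBound ν (fun b => F (a, b)) (B a)) (hB : Integrable B μ)
    (hw : ∫ a, B a ∂μ ≤ w) : SqBound (μ.prod ν) F w := by
  have hm : AEStronglyMeasurable (fun q => ‖F q‖ ^ 2) (μ.prod ν) :=
    (hF.norm.pow_const 2).aestronglyMeasurable
  have hi : Integrable (fun a => ∫ b, ‖F (a, b)‖ ^ 2 ∂ν) μ :=
    hB.mono' hm.integral_prod_right' (ae_of_all _ fun a => by
      rw [Real.norm_of_nonneg (integral_nonneg fun _ => by positivity)]
      exact (h a).sq)
  have hint : Integrable (fun q => ‖F q‖ ^ 2) (μ.prod ν) := by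
    refine (integrable_prod_iff hm).2 ⟨ae_of_all _ fun a => (h a).int, ?_⟩
    simpa using hi
  refine ⟨hF, hint, ?_⟩
  rw [integral_prod _ hint]
  exact (integral_mono hi hB fun a => (h a).sq).trans hw

/-- Law of total variance: `v` bounds the variance of the conditional mean `A`, and `w` the mean of
the conditional variance bound `B`. -/
lemma SqMean.prod [CompleteSpace E] {μ : Measure α} {ν : Measure β} [IsProbabilityMeasure μ]
    [IsProbabilityMeasure ν] {F : α × β → E} {A : α → E} {B : α → ℝ} {m : E} {v w : ℝ}
    (hF : Measurable F) (h : ∀ a, SqMean ν (fun b => F (a, b)) (A a) (B a))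
    (hA : SqMean μ A m v) (hB : Integrable B μ) (hw : ∫ a, B a ∂μ ≤ w) :
    SqMean (μ.prod ν) F m (v + w) := by
  have hb : SqBound (μ.prod ν) F (‖m‖ ^ 2 + (v + w)) := by
    refine SqBound.prod hF (fun a => (h a).bound) (hA.int.add hB) ?_
    rw [integral_add hA.int hB]
    linarith [hA.sq]
  refine ⟨hF, hb.int, ?_, hb.sq⟩
  rw [integral_prod _ (integrable_of_sq hF hb.int)]
  simp_rw [fun a => (h a).mean]
  exact hA.mean

lemma SqMean.pi [CompleteSpace E] {ι : Type*} [Fintype ι] {X : ι → Type*}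
    [∀ i, MeasurableSpace (X i)] {μ : ∀ i, Measure (X i)} [∀ i, IsProbabilityMeasure (μ i)]
    {φ : ∀ i, X i → E} {m : ι → E} {v : ι → ℝ} (h : ∀ i, SqMean (μ i) (φ i) (m i) (v i)) :
    SqMean (Measure.pi μ) (fun x => ∑ i, φ i (x i)) (∑ i, m i) (∑ i, v i) := by
  classical
  have hc : ∀ i, SqMean (Measure.pi μ) (fun x => φ i (x i)) (m i) (v i) := fun i =>
    (h i).comp (measurePreserving_eval μ i)
  have hint := fun i => integrable_of_sq (hc i).meas (hc i).int
  have hin : ∀ i j, Integrable (fun x => inner ℝ (φ i (x i)) (φ j (x j))) (Measure.pi μ) :=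
    fun i j => integrable_inner_of_sq (hc i).meas (hc j).meas (hc i).int (hc j).int
  refine ⟨Finset.measurable_fun_sum _ fun i _ => (hc i).meas,
    integrable_sq_sum (fun i => (hc i).meas) fun i => (hc i).int, ?_, ?_⟩
  · rw [integral_finsetSum _ fun i _ => hint i]
    exact Finset.sum_congr rfl fun i _ => (hc i).mean
  -- Off the diagonal, independence factors the expected inner product into that of the means; only
  -- the diagonal contributes variance.
  · have key : ∀ i j, ∫ x, inner ℝ (φ i (x i)) (φ j (x j)) ∂(Measure.pi μ) ≤
        inner ℝ (m i) (m j) + if i = j then v i else 0 := by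
      intro i j
      by_cases hij : i = j
      · subst hij
        simp only [real_inner_self_eq_norm_sq, if_true]
        exact (hc i).sq
      · have ind : IndepFun (fun x : ∀ i, X i => φ i (x i)) (fun x => φ j (x j))
            (Measure.pi μ) :=
          (iIndepFun_pi (μ := μ) (X := φ) fun i => (h i).meas.aemeasurable).indepFun hij
        have : ∫ x, inner ℝ (φ i (x i)) (φ j (x j)) ∂(Measure.pi μ) =
            inner ℝ (∫ x, φ i (x i) ∂(Measure.pi μ)) (∫ x, φ j (x j) ∂(Measure.pi μ)) :=
          ind.integral_bilin (hint i) (hint j) (innerSL ℝ)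
        rw [this, (hc i).mean, (hc j).mean]
        simp [hij]
    have e : ∀ u : ι → E, ‖∑ i, u i‖ ^ 2 = ∑ i, ∑ j, inner ℝ (u i) (u j) := fun u => by
      rw [← real_inner_self_eq_norm_sq, sum_inner]
      simp_rw [inner_sum]
    rw [e m, integral_congr_ae (ae_of_all _ fun x : ∀ i, X i => e fun i => φ i (x i))]
    rw [integral_finsetSum _ fun i _ => integrable_finsetSum _ fun j _ => hin i j]
    refine (Finset.sum_congr rfl fun i _ =>
      integral_finsetSum Finset.univ fun j _ => hin i j).trans_le ?_
    refine (Finset.sum_le_sum fun i _ => Finset.sum_le_sum fun j _ => key i j).trans ?_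
    simp [Finset.sum_add_distrib]

end SqMean

lemma integral_uniformOn_univ {ι E : Type*} [Fintype ι] [Nonempty ι] [MeasurableSpace ι]
    [MeasurableSingletonClass ι] [NormedAddCommGroup E] [NormedSpace ℝ E] [CompleteSpace E]
    (g : ι → E) :
    ∫ i, g i ∂(uniformOn (Set.univ : Set ι)) = (1 / (Fintype.card ι : ℝ)) • ∑ i, g i := by
  rw [integral_fintype (Integrable.of_finite), Finset.smul_sum]
  refine Finset.sum_congr rfl fun i _ => ?_
  congr 1
  simp [measureReal_def, uniformOn_univ]

/-- The squared norm `d² x_j²` averages to `d ‖x‖²` over `j`. This is where the variance parameter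
`ω = d - 1` comes from. -/
lemma sqMean_rand1 {d : ℕ} (hd : 0 < d) (x : Vec d) :
    SqMean (uniformOn (Set.univ : Set (Fin d))) (fun j => rand1 j x) x
      (((d : ℝ) - 1) * ‖x‖ ^ 2) := by
  have : Nonempty (Fin d) := ⟨⟨0, hd⟩⟩
  have hd' : (d : ℝ) ≠ 0 := by positivity
  refine ⟨measurable_of_finite _, Integrable.of_finite, ?_, ?_⟩
  · rw [integral_uniformOn_univ, Fintype.card_fin]
    ext i
    simp [rand1, Finset.sum_apply, Pi.single_apply, hd']
  · rw [integral_uniformOn_univ, Fintype.card_fin]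
    simp only [rand1, norm_smul, PiLp.norm_single, norm_one, mul_one,
      Real.norm_eq_abs, sq_abs, smul_eq_mul, mul_pow]
    rw [← Finset.mul_sum, EuclideanSpace.norm_sq_eq]
    simp only [Real.norm_eq_abs, sq_abs]
    field_simp
    linarith

lemma measurable_rand1 {d : ℕ} : Measurable fun q : Fin d × Vec d => rand1 q.1 q.2 := by
  refine measurable_from_prod_countable_right fun j => ?_
  have h : Measurable fun x : Vec d => (d : ℝ) * x j :=
    Measurable.const_mul (by fun_prop) _
  exact h.smul_const (EuclideanSpace.single j (1 : ℝ))

/-! ### Smoothness -/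

section Smooth

variable {d : ℕ} {f : Vec d → ℝ} {L : ℝ}

lemma IsLSmooth.mono {L' : ℝ} (h : IsLSmooth f L) (hL : L ≤ L') : IsLSmooth f L' :=
  ⟨h.1, fun x y => (h.2 x y).trans (by gcongr)⟩

lemma IsLSmooth.continuous_gradient (h : IsLSmooth f L) : Continuous (gradient f) := by
  have : LipschitzWith (Real.toNNReal L) (gradient f) := LipschitzWith.of_dist_le_mul fun x y => by
    rw [dist_eq_norm, dist_eq_norm]
    exact (h.2 x y).trans (by gcongr; exact Real.le_coe_toNNReal L)
  exact this.continuous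

lemma IsLSmooth.hasDerivAt_line (h : IsLSmooth f L) (x u : Vec d) (s : ℝ) :
    HasDerivAt (fun s : ℝ => f (x + s • u)) (inner ℝ (gradient f (x + s • u)) u) s := by
  have h1 : HasDerivAt (fun s : ℝ => x + s • u) u s := by
    simpa using ((hasDerivAt_id s).smul_const u).const_add x
  have h2 := ((h.1 (x + s • u)).hasGradientAt.hasFDerivAt).comp_hasDerivAt s h1
  rw [InnerProductSpace.toDual_apply_apply] at h2
  exact h2

/-- Both sides agree at the start of the segment from `x` to `x + u`, and the Lipschitz bound
compares their derivatives along it. -/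
lemma IsLSmooth.le_quadratic (h : IsLSmooth f L) (x u : Vec d) :
    f (x + u) ≤ f x + inner ℝ (gradient f x) u + L / 2 * ‖u‖ ^ 2 := by
  have hB : ∀ s : ℝ, HasDerivAt
      (fun s : ℝ => f x + s * inner ℝ (gradient f x) u + L / 2 * ‖u‖ ^ 2 * s ^ 2)
      (inner ℝ (gradient f x) u + L * ‖u‖ ^ 2 * s) s := by
    intro s
    have h1 := ((hasDerivAt_id s).mul_const (inner ℝ (gradient f x) u)).const_add (f x)
    have h2 := (hasDerivAt_pow 2 s).const_mul (L / 2 * ‖u‖ ^ 2)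
    refine (h1.add h2).congr_deriv ?_
    simp only [one_mul, Nat.cast_ofNat, Nat.add_one_sub_one, pow_one]
    ring
  have := image_le_of_deriv_right_le_deriv_boundary (a := 0) (b := 1)
    (f := fun s : ℝ => f (x + s • u)) (B := _) (B' := _)
    (fun s _ => (h.hasDerivAt_line x u s).continuousAt.continuousWithinAt)
    (fun s _ => (h.hasDerivAt_line x u s).hasDerivWithinAt) (by simp)
    (fun s _ => (hB s).continuousAt.continuousWithinAt)
    (fun s _ => (hB s).hasDerivWithinAt) (fun s hs => ?_)
    (Set.right_mem_Icc.2 zero_le_one)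
  · simpa using this
  · have h1 : inner ℝ (gradient f (x + s • u)) u - inner ℝ (gradient f x) u ≤
        (L * ‖s • u‖) * ‖u‖ := by
      rw [← inner_sub_left]
      refine (real_inner_le_norm _ _).trans ?_
      gcongr
      simpa using h.2 (x + s • u) x
    rw [norm_smul, Real.norm_of_nonneg hs.1] at h1
    linarith

/-- A nonzero gradient would let a long enough step along its negative push `f` below `fstar`. This
settles the trivial case `M = 0`. -/
lemma IsLSmooth.gradient_eq_zero {fstar : ℝ} (h : IsLSmooth f 0) (hf : ∀ x, fstar ≤ f x)
    (x : Vec d) : gradient f x = 0 := by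
  by_contra hne
  have hpos : 0 < ‖gradient f x‖ ^ 2 := by positivity
  have h1 := h.le_quadratic x (-((f x - fstar + 1) / ‖gradient f x‖ ^ 2) • gradient f x)
  have h2 := hf (x + -((f x - fstar + 1) / ‖gradient f x‖ ^ 2) • gradient f x)
  rw [inner_smul_right, real_inner_self_eq_norm_sq, neg_mul, div_mul_cancel₀ _ hpos.ne'] at h1
  linarith

/-- The functional `(L_A, L_B)` inequality for weighted averages. -/
lemma FunctionalAB.weighted {LA LB : ℝ} (h : FunctionalAB f LA LB) {n : ℕ} {β : Fin n → ℝ}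
    (hβ : ∀ i, 0 ≤ β i) (hsum : ∑ i, β i = 1) (x : Vec d) (u : Fin n → Vec d) :
    ‖∑ i, β i • (gradient f (x + u i) - gradient f x)‖ ^ 2 ≤
      LA ^ 2 * ∑ i, β i * ‖u i‖ ^ 2 + LB ^ 2 * ‖∑ i, β i • u i‖ ^ 2 := by
  -- Rational weights `k i / N`: repeat `u i` exactly `k i` times and pad with zero displacements,
  -- which contribute nothing to either side. The padding is what allows `∑ k i < N`.
  have key : ∀ k : Fin n → ℕ, ∀ N : ℕ, 1 ≤ N → ∑ i, k i ≤ N →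
      ‖∑ i, ((k i : ℝ) / N) • (gradient f (x + u i) - gradient f x)‖ ^ 2 ≤
      LA ^ 2 * ∑ i, ((k i : ℝ) / N) * ‖u i‖ ^ 2 + LB ^ 2 * ‖∑ i, ((k i : ℝ) / N) • u i‖ ^ 2 := by
    intro k N hN hk
    let e : Fin N ≃ (Σ i, Fin (k i)) ⊕ Fin (N - ∑ i, k i) :=
      Fintype.equivOfCardEq (by simp; omega)
    let w : (Σ i, Fin (k i)) ⊕ Fin (N - ∑ i, k i) → Vec d := Sum.elim (fun q => u q.1) fun _ => 0
    have hsumE : ∀ {A : Type} [AddCommMonoid A] (F : Vec d → A), F 0 = 0 →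
        ∑ j, F (w (e j)) = ∑ i, k i • F (u i) := by
      intro A _ F hF
      rw [e.sum_comp fun q => F (w q), Fintype.sum_sum_type, Fintype.sum_sigma]
      simp [w, hF]
    have := h.2.2 N hN x fun j => w (e j)
    rw [hsumE (fun v => gradient f (x + v) - gradient f x) (by simp),
      hsumE (fun v => ‖v‖ ^ 2) (by simp), hsumE (fun v => v) rfl] at this
    simp only [Finset.smul_sum, Finset.mul_sum, ← Nat.cast_smul_eq_nsmul ℝ, smul_smul,
      smul_eq_mul] at this
    simpa only [Finset.mul_sum, div_eq_inv_mul, one_div, mul_one, mul_assoc] using this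
  -- Real weights follow by letting `N → ∞` in `⌊β i * N⌋₊ / N`; rounding down keeps the total at
  -- most `N`.
  have lim : ∀ i, Filter.Tendsto (fun N : ℕ => ((⌊β i * (N : ℝ)⌋₊ : ℕ) : ℝ) / (N : ℝ))
      Filter.atTop (nhds (β i)) := fun i =>
    (tendsto_nat_floor_mul_div_atTop (hβ i)).comp tendsto_natCast_atTop_atTop
  refine le_of_tendsto_of_tendsto
    ((tendsto_finsetSum _ fun i _ => (lim i).smul_const _).norm.pow 2)
    (((tendsto_finsetSum _ fun i _ => (lim i).mul_const _).const_mul _).add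
      (((tendsto_finsetSum _ fun i _ => (lim i).smul_const _).norm.pow 2).const_mul _)) ?_
  filter_upwards [Filter.eventually_ge_atTop 1] with N hN
  refine key _ N hN ?_
  have h1 : ((∑ i, ⌊β i * (N : ℝ)⌋₊ : ℕ) : ℝ) ≤ N := by
    push_cast
    calc ∑ i, ((⌊β i * (N : ℝ)⌋₊ : ℕ) : ℝ) ≤ ∑ i, β i * N :=
          Finset.sum_le_sum fun i _ => Nat.floor_le (mul_nonneg (hβ i) N.cast_nonneg)
      _ = N := by rw [← Finset.sum_mul, hsum, one_mul]
  exact_mod_cast h1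

end Smooth

/-! ### The law of the draws of one iteration -/

lemma isProbabilityMeasure_coinLaw {p : ℝ} (hp0 : 0 ≤ p) (hp1 : p ≤ 1) :
    IsProbabilityMeasure (coinLaw p) := ⟨by
  simp only [coinLaw, Measure.coe_add, Measure.coe_smul, Pi.add_apply, Pi.smul_apply,
    measure_univ, smul_eq_mul, mul_one]
  rw [← ENNReal.ofReal_add hp0 (by linarith)]
  simp⟩

lemma integral_coinLaw {p : ℝ} (hp0 : 0 ≤ p) (hp1 : p ≤ 1) (g : Bool → ℝ) :
    ∫ c, g c ∂(coinLaw p) = p * g true + (1 - p) * g false := by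
  have := isProbabilityMeasure_coinLaw hp0 hp1
  rw [coinLaw, integral_add_measure, integral_smul_measure, integral_smul_measure,
    integral_dirac, integral_dirac, ENNReal.toReal_ofReal hp0,
    ENNReal.toReal_ofReal (by linarith)]
  · simp
  · exact (integrable_dirac (by simp)).smul_measure ENNReal.ofReal_ne_top
  · exact (integrable_dirac (by simp)).smul_measure ENNReal.ofReal_ne_top

/-! ### Moments of the gradient estimator and of the displacements in one iteration -/

section OneStep

set_option linter.unusedSectionVars false

variable {n d : ℕ} {Ξ : Type*} [MeasurableSpace Ξ] {f : Vec d → ℝ} {G : Vec d → Ξ → Vec d}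
  {D : Measure Ξ} [IsProbabilityMeasure D] {σ : ℝ} {H : Hyper n}

lemma isProbabilityMeasure_noiseLaw (hd : 0 < d) (hp0 : 0 ≤ H.p) (hp1 : H.p ≤ 1) :
    IsProbabilityMeasure (noiseLaw H d D) := by
  have : Nonempty (Fin d) := ⟨⟨0, hd⟩⟩
  have := isProbabilityMeasure_coinLaw hp0 hp1
  unfold noiseLaw
  infer_instance

/-- The law of the samples and of the coordinates drawn by the workers. -/
def workerLaw (H : Hyper n) (d : ℕ) (D : Measure Ξ) :
    Measure (((i : Fin n) → Fin (H.b i) → Ξ) × ((i : Fin n) → Fin (H.m i) → Fin d)) :=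
  (Measure.pi fun i : Fin n => Measure.pi fun _ : Fin (H.b i) => D).prod
    (Measure.pi fun i : Fin n => Measure.pi fun _ : Fin (H.m i) =>
        uniformOn (Set.univ : Set (Fin d)))

/-- The law of the coordinates drawn by the server and of the coin. -/
def serverLaw (H : Hyper n) (d : ℕ) : Measure (((i : Fin n) → Fin (H.l i) → Fin d) × Bool) :=
  (Measure.pi fun i : Fin n => Measure.pi fun _ : Fin (H.l i) =>
          uniformOn (Set.univ : Set (Fin d))).prod (coinLaw H.p)

/-- The estimator depends only on the first factor and the server's broadcast noise only on the
second, so one can condition on the former. -/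
lemma measurePreserving_split (hd : 0 < d) (hp0 : 0 ≤ H.p) (hp1 : H.p ≤ 1) :
    MeasurePreserving (fun z : Noise H d Ξ => ((z.1, z.2.1), z.2.2)) (noiseLaw H d D)
      ((workerLaw H d D).prod (serverLaw H d)) := by
  have : Nonempty (Fin d) := ⟨⟨0, hd⟩⟩
  have := isProbabilityMeasure_coinLaw hp0 hp1
  exact (measurePreserving_prodAssoc _ _ _).symm MeasurableEquiv.prodAssoc

/-- The aggregated gradient estimator as a function of the draws of the workers. -/
def workerEstimator (H : Hyper n) (G : Vec d → Ξ → Vec d) (y : Fin n → Vec d)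
    (q : ((i : Fin n) → Fin (H.b i) → Ξ) × ((i : Fin n) → Fin (H.m i) → Fin d)) : Vec d :=
  ∑ i, (H.β i / ((H.b i : ℝ) * (H.m i : ℝ))) •
    ∑ j : Fin (H.m i), rand1 (q.2 i j) (∑ r : Fin (H.b i), G (y i) (q.1 i r))

lemma measurable_workerEstimator (hG : Measurable fun q : Vec d × Ξ => G q.1 q.2) :
    Measurable fun s : (Fin n → Vec d) ×
      (((i : Fin n) → Fin (H.b i) → Ξ) × ((i : Fin n) → Fin (H.m i) → Fin d)) =>
      workerEstimator H G s.1 s.2 := by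
  refine Finset.measurable_fun_sum _ fun i _ => Measurable.fun_const_smul
    (Finset.measurable_fun_sum _ fun j _ => ?_) _
  refine measurable_rand1.comp (Measurable.prodMk (by fun_prop)
    (Finset.measurable_fun_sum _ fun r _ => ?_))
  exact hG.comp (Measurable.prodMk (by fun_prop) (by fun_prop))

lemma IsStochasticGradient.sqMean (h : IsStochasticGradient f G D σ) (x : Vec d) :
    SqMean D (G x) (gradient f x) (σ ^ 2) := by
  obtain ⟨hm, h⟩ := h
  obtain ⟨h1, h2, h3, h4⟩ := h x
  have hmx : Measurable (G x) := hm.comp measurable_prodMk_left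
  have h0 : SqMean D (fun ξ => G x ξ - gradient f x) 0 (σ ^ 2) := by
    refine ⟨hmx.sub_const _, h3, ?_, by simpa using h4⟩
    rw [integral_sub h1 (integrable_const _), h2]
    simp
  simpa using h0.const_add (gradient f x)

/-- The mean of the aggregated gradient estimator. -/
def meanEstimator (H : Hyper n) (f : Vec d → ℝ) (y : Fin n → Vec d) : Vec d :=
  ∑ i, H.β i • gradient f (y i)

/-- The bound for the variance of the aggregated gradient estimator. -/
def varEstimator (H : Hyper n) (f : Vec d → ℝ) (σ : ℝ) (y : Fin n → Vec d) : ℝ :=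
  ∑ i, H.β i ^ 2 * (σ ^ 2 / H.b i +
    ((d : ℝ) - 1) / H.m i * (‖gradient f (y i)‖ ^ 2 + σ ^ 2 / H.b i))

/-- Condition on the samples. The compressors are unbiased around the batch sums (`hC`), the batch
sums are unbiased around the gradients (`hA`), and the law of total variance adds the two
contributions. The second moment of a batch sum, `b² ‖∇f‖² + b σ²`, multiplies the compression
variance. -/
lemma sqMean_workerEstimator (hd : 0 < d) (hb : ∀ i, 0 < H.b i) (hm : ∀ i, 0 < H.m i)
    (h : IsStochasticGradient f G D σ) (y : Fin n → Vec d) :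
    SqMean (workerLaw H d D) (workerEstimator H G y) (meanEstimator H f y)
      (varEstimator H f σ y) := by
  have : Nonempty (Fin d) := ⟨⟨0, hd⟩⟩
  have hd1 : (0 : ℝ) ≤ (d : ℝ) - 1 := by
    have : (1 : ℝ) ≤ d := by exact_mod_cast hd
    linarith
  have hb' : ∀ i, (H.b i : ℝ) ≠ 0 := fun i => by have := hb i; positivity
  have hm' : ∀ i, (H.m i : ℝ) ≠ 0 := fun i => by have := hm i; positivity
  have hS : ∀ i, SqMean (Measure.pi fun _ : Fin (H.b i) => D)
      (fun ξ => ∑ r, G (y i) (ξ r)) ((H.b i : ℝ) • gradient f (y i)) (H.b i * σ ^ 2) := by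
    intro i
    have := SqMean.pi (μ := fun _ : Fin (H.b i) => D) fun _ => h.sqMean (y i)
    simpa [← Nat.cast_smul_eq_nsmul ℝ] using this
  have hA : SqMean (Measure.pi fun i : Fin n => Measure.pi fun _ : Fin (H.b i) => D)
      (fun ξ => ∑ i, (H.β i / H.b i) • ∑ r, G (y i) (ξ i r)) (meanEstimator H f y)
      (∑ i, H.β i ^ 2 * (σ ^ 2 / H.b i)) := by
    convert SqMean.pi fun i => (hS i).smul (H.β i / H.b i) using 1
    · refine Finset.sum_congr rfl fun i _ => ?_
      rw [smul_smul, div_mul_cancel₀ _ (hb' i)]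
    · refine Finset.sum_congr rfl fun i _ => ?_
      have := hb' i
      field_simp
  have hC : ∀ (x : Fin n → Vec d), SqMean (Measure.pi fun i : Fin n =>
      Measure.pi fun _ : Fin (H.m i) => uniformOn (Set.univ : Set (Fin d)))
      (fun J => ∑ i, (H.β i / ((H.b i : ℝ) * (H.m i : ℝ))) •
        ∑ j : Fin (H.m i), rand1 (J i j) (x i)) (∑ i, (H.β i / H.b i) • x i)
      (∑ i, H.β i ^ 2 * (((d : ℝ) - 1) / (H.m i * H.b i ^ 2)) * ‖x i‖ ^ 2) := by
    intro x
    have h1 : ∀ i, SqMean (Measure.pi fun _ : Fin (H.m i) => uniformOn (Set.univ : Set (Fin d)))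
        (fun J => ∑ j, rand1 (J j) (x i)) ((H.m i : ℝ) • x i)
        (H.m i * (((d : ℝ) - 1) * ‖x i‖ ^ 2)) := by
      intro i
      have := SqMean.pi (μ := fun _ : Fin (H.m i) => uniformOn (Set.univ : Set (Fin d)))
        fun _ => sqMean_rand1 hd (x i)
      simpa [← Nat.cast_smul_eq_nsmul ℝ] using this
    convert SqMean.pi fun i => (h1 i).smul (H.β i / ((H.b i : ℝ) * (H.m i : ℝ))) using 1
    · refine Finset.sum_congr rfl fun i _ => ?_
      rw [smul_smul]
      congr 1
      have := hb' i
      have := hm' i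
      field_simp
    · refine Finset.sum_congr rfl fun i _ => ?_
      have := hb' i
      have := hm' i
      field_simp
  have hSc : ∀ i, SqMean (Measure.pi fun i : Fin n => Measure.pi fun _ : Fin (H.b i) => D)
      (fun ξ => ∑ r, G (y i) (ξ i r)) ((H.b i : ℝ) • gradient f (y i)) (H.b i * σ ^ 2) :=
    fun i => (hS i).comp (measurePreserving_eval _ i)
  have hB : ∀ i, Integrable (fun ξ : (i : Fin n) → Fin (H.b i) → Ξ => H.β i ^ 2 *
      (((d : ℝ) - 1) / (H.m i * H.b i ^ 2)) * ‖∑ r, G (y i) (ξ i r)‖ ^ 2)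
      (Measure.pi fun i : Fin n => Measure.pi fun _ : Fin (H.b i) => D) :=
    fun i => (hSc i).int.const_mul _
  refine (SqMean.prod (w := ∑ i, H.β i ^ 2 * (((d : ℝ) - 1) / H.m i *
    (‖gradient f (y i)‖ ^ 2 + σ ^ 2 / H.b i)))
    ((measurable_workerEstimator h.1).comp measurable_prodMk_left)
    (fun ξ => hC fun i => ∑ r, G (y i) (ξ i r)) hA (integrable_finsetSum _ fun i _ => hB i)
    ?_).mono (le_of_eq ?_)
  · rw [integral_finsetSum _ fun i _ => hB i]
    refine Finset.sum_le_sum fun i _ => ?_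
    rw [integral_const_mul]
    have h1 := (hSc i).sq
    rw [norm_smul, mul_pow, Real.norm_natCast] at h1
    refine (mul_le_mul_of_nonneg_left h1 (by positivity)).trans (le_of_eq ?_)
    have := hb' i
    have := hm' i
    field_simp
  · rw [varEstimator, ← Finset.sum_add_distrib]
    exact Finset.sum_congr rfl fun i _ => by ring

/-- The displacement of the workers from the server after one iteration. -/
lemma step_sub (S : Vec d × (Fin n → Vec d)) (z : Noise H d Ξ) (i : Fin n) :
    (step H G S z).2 i - (step H G S z).1 = if z.2.2.2 = true then 0 else
      (S.2 i - S.1) + ((1 / (H.l i : ℝ)) • ∑ j : Fin (H.l i),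
        rand1 (z.2.2.1 i j) (-(H.γ • gradEstimator H G S.2 z)) +
          H.γ • gradEstimator H G S.2 z) := by
  have e : S.1 - H.γ • gradEstimator H G S.2 z - S.1 = -(H.γ • gradEstimator H G S.2 z) := by
    abel
  simp only [step]
  split_ifs
  · simp
  · rw [e]
    abel

lemma sqMean_gradEstimator (hd : 0 < d) (hp0 : 0 ≤ H.p) (hp1 : H.p ≤ 1)
    (hb : ∀ i, 0 < H.b i) (hm : ∀ i, 0 < H.m i)
    (h : IsStochasticGradient f G D σ) (y : Fin n → Vec d) :
    SqMean (noiseLaw H d D) (gradEstimator H G y) (meanEstimator H f y)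
      (varEstimator H f σ y) := by
  have : Nonempty (Fin d) := ⟨⟨0, hd⟩⟩
  have := isProbabilityMeasure_coinLaw hp0 hp1
  have : IsProbabilityMeasure (serverLaw H d) := by
    unfold serverLaw
    infer_instance
  have : IsProbabilityMeasure (workerLaw H d D) := by
    unfold workerLaw
    infer_instance
  have h1 : SqMean ((workerLaw H d D).prod (serverLaw H d))
      (fun q => workerEstimator H G y q.1) (meanEstimator H f y) (varEstimator H f σ y) :=
    (sqMean_workerEstimator hd hb hm h y).comp measurePreserving_fst
  have h2 := h1.comp (measurePreserving_split (D := D) hd hp0 hp1)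
  exact h2

/-- A linear combination of the displacements of the workers after an iteration, where `u` is the
combination before the iteration and `x` the displacement of the server. -/
def displacement (H : Hyper n) (c : Fin n → ℝ) (u : Vec d) (x : Vec d)
    (q : ((i : Fin n) → Fin (H.l i) → Fin d) × Bool) : Vec d :=
  if q.2 = true then 0 else (u + -((∑ i, c i) • x)) +
    ∑ i, (c i * (1 / (H.l i : ℝ))) • ∑ j : Fin (H.l i), rand1 (q.1 i j) x

lemma measurable_displacement (c : Fin n → ℝ) (u : Vec d) :
    Measurable fun s : Vec d × (((i : Fin n) → Fin (H.l i) → Fin d) × Bool) =>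
      displacement H c u s.1 s.2 := by
  refine Measurable.ite ((measurable_snd.comp measurable_snd) (measurableSet_singleton true))
    measurable_const (Measurable.add (by fun_prop) ?_)
  refine Finset.measurable_fun_sum _ fun i _ => Measurable.fun_const_smul
    (Finset.measurable_fun_sum _ fun j _ => ?_) _
  exact measurable_rand1.comp (Measurable.prodMk (by fun_prop) (by fun_prop))

/-- With probability `p` the displacement vanishes. Otherwise the mean of the compressed messages
cancels the move of the server, which leaves the mean `u`. The messages to different workers are
independent, so their variances add with coefficients `c i ^ 2`. -/
lemma sqBound_displacement (hd : 0 < d) (hp0 : 0 ≤ H.p) (hp1 : H.p ≤ 1)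
    (hl : ∀ i, 0 < H.l i) (c : Fin n → ℝ) (u x : Vec d) :
    SqBound (serverLaw H d) (displacement H c u x)
      ((1 - H.p) * (‖u‖ ^ 2 + (∑ i, c i ^ 2 * (((d : ℝ) - 1) / H.l i)) * ‖x‖ ^ 2)) := by
  have : Nonempty (Fin d) := ⟨⟨0, hd⟩⟩
  have := isProbabilityMeasure_coinLaw hp0 hp1
  have hl' : ∀ i, (H.l i : ℝ) ≠ 0 := fun i => by have := hl i; positivity
  set R := ∑ i, c i ^ 2 * (((d : ℝ) - 1) / H.l i) with hR
  have hQ : SqMean (Measure.pi fun i : Fin n => Measure.pi fun _ : Fin (H.l i) =>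
      uniformOn (Set.univ : Set (Fin d)))
      (fun J => (u + -((∑ i, c i) • x)) +
        ∑ i, (c i * (1 / (H.l i : ℝ))) • ∑ j : Fin (H.l i), rand1 (J i j) x)
      u (R * ‖x‖ ^ 2) := by
    have h1 : ∀ i, SqMean (Measure.pi fun _ : Fin (H.l i) => uniformOn (Set.univ : Set (Fin d)))
        (fun J => ∑ j, rand1 (J j) x) ((H.l i : ℝ) • x)
        (H.l i * (((d : ℝ) - 1) * ‖x‖ ^ 2)) := by
      intro i
      have := SqMean.pi (μ := fun _ : Fin (H.l i) => uniformOn (Set.univ : Set (Fin d)))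
        fun _ => sqMean_rand1 hd x
      simpa [← Nat.cast_smul_eq_nsmul ℝ] using this
    convert (SqMean.pi fun i => (h1 i).smul (c i * (1 / (H.l i : ℝ)))).const_add
      (u + -((∑ i, c i) • x)) using 1
    · have : ∑ i, (c i * (1 / (H.l i : ℝ))) • (H.l i : ℝ) • x = (∑ i, c i) • x := by
        rw [Finset.sum_smul]
        refine Finset.sum_congr rfl fun i _ => ?_
        rw [smul_smul, mul_assoc, one_div_mul_cancel (hl' i), mul_one]
      rw [this]
      abel
    · rw [hR, Finset.sum_mul]
      refine Finset.sum_congr rfl fun i _ => ?_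
      have := hl' i
      field_simp
  have hmeas : Measurable (displacement H c u x) :=
    (measurable_displacement c u).comp (measurable_const.prodMk measurable_id)
  have hcoin : ∀ J : (i : Fin n) → Fin (H.l i) → Fin d, SqBound (coinLaw H.p)
      (fun b => displacement H c u x (J, b)) ((1 - H.p) * ‖(u + -((∑ i, c i) • x)) +
      ∑ i, (c i * (1 / (H.l i : ℝ))) • ∑ j : Fin (H.l i), rand1 (J i j) x‖ ^ 2) := by
    intro J
    refine ⟨measurable_of_finite _, Integrable.of_finite, ?_⟩
    rw [integral_coinLaw hp0 hp1]
    simp [displacement]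
  refine SqBound.prod hmeas hcoin (hQ.int.const_mul _) ?_
  · rw [integral_const_mul]
    exact mul_le_mul_of_nonneg_left hQ.sq (by linarith)

lemma sum_smul_step_sub (c : Fin n → ℝ) (S : Vec d × (Fin n → Vec d)) (z : Noise H d Ξ) :
    ∑ i, c i • ((step H G S z).2 i - (step H G S z).1) =
      displacement H c (∑ i, c i • (S.2 i - S.1))
        (-(H.γ • workerEstimator H G S.2 (z.1, z.2.1))) z.2.2 := by
  have e : workerEstimator H G S.2 (z.1, z.2.1) = gradEstimator H G S.2 z := rfl
  simp only [step_sub, displacement, e]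
  split_ifs
  · simp
  · simp only [smul_add, Finset.sum_add_distrib, smul_smul, ← Finset.sum_smul, smul_neg, neg_neg,
      Finset.sum_mul]
    abel

/-- The coefficients `c` are arbitrary so that the same bound serves a single worker (`c` a
coordinate vector) and the weighted mean (`c = β`), the two kinds of terms in `spread`. -/
lemma sqBound_combination (hd : 0 < d) (hp0 : 0 ≤ H.p) (hp1 : H.p ≤ 1)
    (hb : ∀ i, 0 < H.b i) (hm : ∀ i, 0 < H.m i) (hl : ∀ i, 0 < H.l i)
    (h : IsStochasticGradient f G D σ) (S : Vec d × (Fin n → Vec d)) (c : Fin n → ℝ) :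
    SqBound (noiseLaw H d D)
      (fun z => ∑ i, c i • ((step H G S z).2 i - (step H G S z).1))
      ((1 - H.p) * (‖∑ i, c i • (S.2 i - S.1)‖ ^ 2 +
        (∑ i, c i ^ 2 * (((d : ℝ) - 1) / H.l i)) * (H.γ ^ 2 *
          (‖meanEstimator H f S.2‖ ^ 2 + varEstimator H f σ S.2)))) := by
  have : Nonempty (Fin d) := ⟨⟨0, hd⟩⟩
  have := isProbabilityMeasure_coinLaw hp0 hp1
  have : IsProbabilityMeasure (serverLaw H d) := by
    unfold serverLaw
    infer_instance
  have : IsProbabilityMeasure (workerLaw H d D) := by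
    unfold workerLaw
    infer_instance
  have hd1 : (0 : ℝ) ≤ (d : ℝ) - 1 := by
    have : (1 : ℝ) ≤ d := by exact_mod_cast hd
    linarith
  set u := ∑ i, c i • (S.2 i - S.1) with hu
  set R := ∑ i, c i ^ 2 * (((d : ℝ) - 1) / H.l i) with hR
  have hR0 : 0 ≤ R := Finset.sum_nonneg fun i _ => by positivity
  have hg := (sqMean_workerEstimator hd hb hm h S.2).smul H.γ
  have hgm : Measurable (workerEstimator H G S.2) :=
    (sqMean_workerEstimator hd hb hm h S.2).meas
  have hmain : SqBound ((workerLaw H d D).prod (serverLaw H d))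
      (fun q => displacement H c u (-(H.γ • workerEstimator H G S.2 q.1)) q.2)
      ((1 - H.p) * (‖u‖ ^ 2 + R * (H.γ ^ 2 *
          (‖meanEstimator H f S.2‖ ^ 2 + varEstimator H f σ S.2)))) := by
    refine SqBound.prod (B := fun a => (1 - H.p) * (‖u‖ ^ 2 +
      R * ‖H.γ • workerEstimator H G S.2 a‖ ^ 2)) ?_ (fun a => ?_) ?_ ?_
    · exact (measurable_displacement c u).comp (Measurable.prodMk (by fun_prop) measurable_snd)
    · have h1 := sqBound_displacement hd hp0 hp1 hl c u (-(H.γ • workerEstimator H G S.2 a))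
      rw [norm_neg] at h1
      exact h1
    · exact ((integrable_const _).add (hg.int.const_mul _)).const_mul _
    · rw [integral_const_mul, integral_add (integrable_const _) (hg.int.const_mul _),
        integral_const_mul]
      simp only [integral_const, probReal_univ, smul_eq_mul, one_mul]
      have := hg.sq
      rw [norm_smul, mul_pow, Real.norm_eq_abs, sq_abs] at this
      rw [mul_add (H.γ ^ 2)]
      have hq : (0 : ℝ) ≤ 1 - H.p := by linarith
      gcongr
  have h2 := hmain.comp (measurePreserving_split (D := D) hd hp0 hp1)
  simp only [sum_smul_step_sub]
  exact h2

end OneStep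

/-! ### Descent of the Lyapunov function -/

/-- The conditions on the parameters under which the method converges. -/
structure Hyper.Admissible {n : ℕ} (H : Hyper n) (d : ℕ) (Lm LA σ ε M : ℝ) : Prop where
  d_pos : 0 < d
  b_pos : ∀ i, 0 < H.b i
  m_pos : ∀ i, 0 < H.m i
  l_pos : ∀ i, 0 < H.l i
  p_pos : 0 < H.p
  p_le : H.p ≤ 1
  β_nonneg : ∀ i, 0 ≤ H.β i
  β_sum : ∑ i, H.β i = 1
  M_pos : 0 < M
  Lm_nonneg : 0 ≤ Lm
  Lm_le : Lm ≤ M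
  γ_eq : H.γ = 1 / (6 * M)
  drift_le : LA ^ 2 * ∑ i, H.β i * (((d : ℝ) - 1) / H.l i) ≤ H.p * M ^ 2
  spread_le : Lm ^ 2 * ∑ i, H.β i ^ 2 * (((d : ℝ) - 1) / H.l i +
    ((d : ℝ) - 1) / H.m i * (((d : ℝ) - 1) / H.l i)) ≤ H.p * M ^ 2
  -- Here and in `noise_le`, `17/64` is `1/8 * 17/8`: the factor 8 comes from the inverse weights,
  -- and `17/8` bounds the reciprocal of the total weight.
  compress_le : ∑ i, H.β i ^ 2 * (((d : ℝ) - 1) / H.m i) ≤ 17 / 64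
  noise_le : ∑ i, H.β i ^ 2 * (σ ^ 2 / H.b i + ((d : ℝ) - 1) / H.m i * (σ ^ 2 / H.b i)) ≤
    17 / 64 * ε

section Lyapunov

variable {n d : ℕ} {Ξ : Type*} [MeasurableSpace Ξ] {f : Vec d → ℝ} {G : Vec d → Ξ → Vec d}
  {D : Measure Ξ} {σ : ℝ} {H : Hyper n} {Lm LA ε M : ℝ}

/-- The part of the Lyapunov function measuring how far the workers are from the server. -/
def spread (H : Hyper n) (Lm LA : ℝ) (S : Vec d × (Fin n → Vec d)) : ℝ :=
  LA ^ 2 * ∑ i, H.β i * ‖S.2 i - S.1‖ ^ 2 + Lm ^ 2 * ‖∑ i, H.β i • (S.2 i - S.1)‖ ^ 2 +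
    Lm ^ 2 * ∑ i, H.β i ^ 2 * (((d : ℝ) - 1) / H.m i) * ‖S.2 i - S.1‖ ^ 2

/-- The Lyapunov function. -/
def lyapunov (H : Hyper n) (Lm LA fstar : ℝ) (f : Vec d → ℝ) (S : Vec d × (Fin n → Vec d)) : ℝ :=
  f S.1 - fstar + H.γ / (2 * H.p) * spread H Lm LA S

/-- The bound for the second moment of the aggregated gradient estimator. -/
def momentEstimator (H : Hyper n) (f : Vec d → ℝ) (σ : ℝ) (y : Fin n → Vec d) : ℝ :=
  ‖meanEstimator H f y‖ ^ 2 + varEstimator H f σ y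

lemma Hyper.Admissible.sub_one_nonneg (A : H.Admissible d Lm LA σ ε M) : (0 : ℝ) ≤ (d : ℝ) - 1 := by
  have : (1 : ℝ) ≤ d := by exact_mod_cast A.d_pos
  linarith

lemma Hyper.Admissible.γ_pos (A : H.Admissible d Lm LA σ ε M) : 0 < H.γ := by
  rw [A.γ_eq]
  have := A.M_pos
  positivity

lemma Hyper.Admissible.varEstimator_nonneg (A : H.Admissible d Lm LA σ ε M)
    (y : Fin n → Vec d) : 0 ≤ varEstimator H f σ y :=
  Finset.sum_nonneg fun i _ => by
    have := A.sub_one_nonneg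
    positivity

lemma Hyper.Admissible.spread_nonneg (A : H.Admissible d Lm LA σ ε M)
    (S : Vec d × (Fin n → Vec d)) : 0 ≤ spread H Lm LA S := by
  have h1 := A.sub_one_nonneg
  have h2 : 0 ≤ ∑ i, H.β i * ‖S.2 i - S.1‖ ^ 2 :=
    Finset.sum_nonneg fun i _ => mul_nonneg (A.β_nonneg i) (by positivity)
  have h3 : 0 ≤ ∑ i, H.β i ^ 2 * (((d : ℝ) - 1) / H.m i) * ‖S.2 i - S.1‖ ^ 2 :=
    Finset.sum_nonneg fun i _ => by positivity
  unfold spread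
  positivity

/-- The factor `1 - p` is the chance of no synchronization. The fresh compression noise of the first
part of `spread` is bounded by `drift_le` and that of the other two together by `spread_le`, each
giving `p M²`. -/
lemma integral_spread_step [IsProbabilityMeasure D] (A : H.Admissible d Lm LA σ ε M)
    (h : IsStochasticGradient f G D σ) (S : Vec d × (Fin n → Vec d)) :
    Integrable (fun z => spread H Lm LA (step H G S z)) (noiseLaw H d D) ∧
    ∫ z, spread H Lm LA (step H G S z) ∂(noiseLaw H d D) ≤
      (1 - H.p) * (spread H Lm LA S +
        2 * H.p * M ^ 2 * (H.γ ^ 2 * momentEstimator H f σ S.2)) := by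
  classical
  have hd1 := A.sub_one_nonneg
  have hC := sqBound_combination A.d_pos A.p_pos.le A.p_le A.b_pos A.m_pos A.l_pos h S
  have hsingle : ∀ i, SqBound (noiseLaw H d D)
      (fun z => (step H G S z).2 i - (step H G S z).1)
      ((1 - H.p) * (‖S.2 i - S.1‖ ^ 2 + (((d : ℝ) - 1) / H.l i) * (H.γ ^ 2 *
          momentEstimator H f σ S.2))) := by
    intro i
    simpa [Pi.single_apply, ite_pow, momentEstimator] using hC (Pi.single i 1)
  have hβ := hC H.β
  set q := H.γ ^ 2 * momentEstimator H f σ S.2 with hq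
  have hq0 : 0 ≤ q := mul_nonneg (sq_nonneg _)
    (add_nonneg (sq_nonneg _) (A.varEstimator_nonneg _))
  have i1 : ∀ i, Integrable (fun z => H.β i * ‖(step H G S z).2 i - (step H G S z).1‖ ^ 2)
      (noiseLaw H d D) := fun i => (hsingle i).int.const_mul _
  have i3 : ∀ i, Integrable (fun z => H.β i ^ 2 * (((d : ℝ) - 1) / H.m i) *
      ‖(step H G S z).2 i - (step H G S z).1‖ ^ 2)
      (noiseLaw H d D) := fun i => (hsingle i).int.const_mul _
  have j1 := (integrable_finsetSum Finset.univ fun i _ => i1 i).const_mul (LA ^ 2)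
  have j2 := hβ.int.const_mul (Lm ^ 2)
  have j3 := (integrable_finsetSum Finset.univ fun i _ => i3 i).const_mul (Lm ^ 2)
  have j12 : Integrable (fun z => LA ^ 2 * ∑ i, H.β i *
      ‖(step H G S z).2 i - (step H G S z).1‖ ^ 2 + Lm ^ 2 *
      ‖∑ i, H.β i • ((step H G S z).2 i - (step H G S z).1)‖ ^ 2) (noiseLaw H d D) := j1.add j2
  refine ⟨j12.add j3, ?_⟩
  unfold spread
  rw [integral_add j12 j3, integral_add j1 j2, integral_const_mul, integral_const_mul,
    integral_const_mul, integral_finsetSum _ fun i _ => i1 i,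
    integral_finsetSum _ fun i _ => i3 i]
  have k1 : ∑ i, ∫ z, H.β i * ‖(step H G S z).2 i - (step H G S z).1‖ ^ 2 ∂(noiseLaw H d D) ≤
      (1 - H.p) * (∑ i, H.β i * ‖S.2 i - S.1‖ ^ 2 +
        (∑ i, H.β i * (((d : ℝ) - 1) / H.l i)) * q) := by
    rw [Finset.sum_mul, ← Finset.sum_add_distrib, Finset.mul_sum]
    refine Finset.sum_le_sum fun i _ => ?_
    rw [integral_const_mul]
    refine (mul_le_mul_of_nonneg_left (hsingle i).sq (A.β_nonneg i)).trans (le_of_eq ?_)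
    ring
  have k3 : ∑ i, ∫ z, H.β i ^ 2 * (((d : ℝ) - 1) / H.m i) *
      ‖(step H G S z).2 i - (step H G S z).1‖ ^ 2 ∂(noiseLaw H d D) ≤
      (1 - H.p) * (∑ i, H.β i ^ 2 * (((d : ℝ) - 1) / H.m i) * ‖S.2 i - S.1‖ ^ 2 +
        (∑ i, H.β i ^ 2 * (((d : ℝ) - 1) / H.m i * (((d : ℝ) - 1) / H.l i))) * q) := by
    rw [Finset.sum_mul, ← Finset.sum_add_distrib, Finset.mul_sum]
    refine Finset.sum_le_sum fun i _ => ?_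
    rw [integral_const_mul]
    refine (mul_le_mul_of_nonneg_left (hsingle i).sq (by positivity)).trans (le_of_eq ?_)
    ring
  have k2 := hβ.sq
  change _ ≤ (1 - H.p) * (_ + _ * q) at k2
  have s2 := A.spread_le
  simp only [mul_add, Finset.sum_add_distrib] at s2
  have hp : 0 ≤ 1 - H.p := by linarith [A.p_le]
  have e1 := mul_le_mul_of_nonneg_left k1 (sq_nonneg LA)
  have e2 := mul_le_mul_of_nonneg_left k2 (sq_nonneg Lm)
  have e3 := mul_le_mul_of_nonneg_left k3 (sq_nonneg Lm)
  have e4 := mul_le_mul_of_nonneg_left (mul_le_mul_of_nonneg_right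
    (add_le_add A.drift_le s2) hq0) hp
  linarith

/-- Smoothness replaces the gradients at the workers by the one at the server, with a factor 2 from
squaring a sum; hence `2 * 17/64 = 17/32`. -/
lemma Hyper.Admissible.varEstimator_le (A : H.Admissible d Lm LA σ ε M) (hf : IsLSmooth f Lm)
    (S : Vec d × (Fin n → Vec d)) :
    varEstimator H f σ S.2 ≤ 17 / 32 * ‖gradient f S.1‖ ^ 2 +
      2 * (Lm ^ 2 * ∑ i, H.β i ^ 2 * (((d : ℝ) - 1) / H.m i) * ‖S.2 i - S.1‖ ^ 2) +
      17 / 64 * ε := by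
  have hd1 := A.sub_one_nonneg
  have hg : ∀ i, ‖gradient f (S.2 i)‖ ^ 2 ≤
      2 * ‖gradient f S.1‖ ^ 2 + 2 * (Lm ^ 2 * ‖S.2 i - S.1‖ ^ 2) := by
    intro i
    have h1 := hf.2 (S.2 i) S.1
    have h2 : ‖gradient f (S.2 i)‖ ≤ ‖gradient f S.1‖ + Lm * ‖S.2 i - S.1‖ := by
      have := norm_add_le (gradient f S.1) (gradient f (S.2 i) - gradient f S.1)
      rw [add_sub_cancel] at this
      linarith
    have h3 := pow_le_pow_left₀ (norm_nonneg _) h2 2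
    nlinarith [sq_nonneg (‖gradient f S.1‖ - Lm * ‖S.2 i - S.1‖)]
  have h1 : varEstimator H f σ S.2 ≤
      2 * ‖gradient f S.1‖ ^ 2 * (∑ i, H.β i ^ 2 * (((d : ℝ) - 1) / H.m i)) +
      2 * (Lm ^ 2 * ∑ i, H.β i ^ 2 * (((d : ℝ) - 1) / H.m i) * ‖S.2 i - S.1‖ ^ 2) +
      ∑ i, H.β i ^ 2 * (σ ^ 2 / H.b i + ((d : ℝ) - 1) / H.m i * (σ ^ 2 / H.b i)) := by
    rw [Finset.mul_sum, Finset.mul_sum, Finset.mul_sum, ← Finset.sum_add_distrib,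
      ← Finset.sum_add_distrib]
    refine Finset.sum_le_sum fun i _ => ?_
    have h0 : 0 ≤ H.β i ^ 2 * (((d : ℝ) - 1) / H.m i) := by positivity
    have := mul_le_mul_of_nonneg_left (hg i) h0
    linarith
  have h2 := mul_le_mul_of_nonneg_left A.compress_le
    (by positivity : 0 ≤ 2 * ‖gradient f S.1‖ ^ 2)
  linarith [A.noise_le]

/-- Polarization: `-2⟪a, b⟫ = ‖b - a‖² - ‖a‖² - ‖b‖²`, where `b - a` is a weighted average of
gradient differences, to which the weighted `(L_A, L_B)` inequality applies. -/
lemma Hyper.Admissible.neg_inner_le (A : H.Admissible d Lm LA σ ε M) {LB : ℝ} (hLB : LB ≤ Lm)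
    (hf : FunctionalAB f LA LB) (S : Vec d × (Fin n → Vec d)) :
    -inner ℝ (gradient f S.1) (meanEstimator H f S.2) ≤
      (LA ^ 2 * ∑ i, H.β i * ‖S.2 i - S.1‖ ^ 2 + Lm ^ 2 * ‖∑ i, H.β i • (S.2 i - S.1)‖ ^ 2 -
        ‖gradient f S.1‖ ^ 2 - ‖meanEstimator H f S.2‖ ^ 2) / 2 := by
  have h1 := hf.weighted A.β_nonneg A.β_sum S.1 fun i => S.2 i - S.1
  have h2 : ∑ i, H.β i • (gradient f (S.1 + (S.2 i - S.1)) - gradient f S.1) =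
      meanEstimator H f S.2 - gradient f S.1 := by
    simp only [add_sub_cancel, smul_sub, Finset.sum_sub_distrib, ← Finset.sum_smul, A.β_sum,
      one_smul, meanEstimator]
  rw [h2, norm_sub_sq_real, real_inner_comm] at h1
  have h3 : LB ^ 2 * ‖∑ i, H.β i • (S.2 i - S.1)‖ ^ 2 ≤
      Lm ^ 2 * ‖∑ i, H.β i • (S.2 i - S.1)‖ ^ 2 := by
    gcongr
    exact hf.2.1
  linarith

lemma measurable_step_fst [IsProbabilityMeasure D] (A : H.Admissible d Lm LA σ ε M)
    (h : IsStochasticGradient f G D σ) (S : Vec d × (Fin n → Vec d)) :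
    Measurable fun z => (step H G S z).1 :=
  ((sqMean_gradEstimator A.d_pos A.p_pos.le A.p_le A.b_pos A.m_pos h S.2).meas.fun_const_smul
    H.γ).const_sub S.1

/-- The expected decrease of the Lyapunov function in one iteration. -/
lemma integral_lyapunov_step [IsProbabilityMeasure D] (A : H.Admissible d Lm LA σ ε M)
    {LB fstar : ℝ} (hLB : LB ≤ Lm) (hε : 0 ≤ ε)
    (h : IsStochasticGradient f G D σ) (hs : IsLSmooth f Lm) (hAB : FunctionalAB f LA LB)
    (hf : ∀ x, fstar ≤ f x) (S : Vec d × (Fin n → Vec d)) :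
    Integrable (fun z => lyapunov H Lm LA fstar f (step H G S z)) (noiseLaw H d D) ∧
    ∫ z, lyapunov H Lm LA fstar f (step H G S z) ∂(noiseLaw H d D) +
        2 / 5 * H.γ * ‖gradient f S.1‖ ^ 2 ≤
      lyapunov H Lm LA fstar f S + 3 / 100 * H.γ * ε := by
  have hγ := A.γ_pos
  have hM := A.M_pos
  have hp := A.p_pos
  have := isProbabilityMeasure_noiseLaw (D := D) (H := H) A.d_pos A.p_pos.le A.p_le
  have hg := sqMean_gradEstimator A.d_pos A.p_pos.le A.p_le A.b_pos A.m_pos h S.2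
  have hgi := integrable_of_sq hg.meas hg.int
  obtain ⟨vi, vle⟩ := integral_spread_step A h S
  set g := gradEstimator H G S.2 with hgdef
  have hup : ∀ z, f (step H G S z).1 ≤ f S.1 + -H.γ * inner ℝ (gradient f S.1) (g z) +
      Lm / 2 * H.γ ^ 2 * ‖g z‖ ^ 2 := by
    intro z
    have := hs.le_quadratic S.1 (-(H.γ • g z))
    rw [← sub_eq_add_neg, inner_neg_right, inner_smul_right, norm_neg, norm_smul, mul_pow,
      Real.norm_eq_abs, sq_abs] at this
    calc _ ≤ _ := this
      _ = _ := by ring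
  have u1 : Integrable (fun z => -H.γ * inner ℝ (gradient f S.1) (g z)) (noiseLaw H d D) :=
    (hgi.const_inner _).const_mul _
  have u2 : Integrable (fun z => Lm / 2 * H.γ ^ 2 * ‖g z‖ ^ 2) (noiseLaw H d D) :=
    hg.int.const_mul _
  have u3 : Integrable (fun z => f S.1 + -H.γ * inner ℝ (gradient f S.1) (g z))
    (noiseLaw H d D) := (integrable_const _).add u1
  -- `f` is squeezed between the constant `fstar` and the integrable quadratic upper bound.
  have fi : Integrable (fun z => f (step H G S z).1) (noiseLaw H d D) := by
    refine ((u3.add u2).norm.add (integrable_const |fstar|)).mono'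
      (hs.1.continuous.measurable.comp (measurable_step_fst A h S)).aestronglyMeasurable
      (ae_of_all _ fun z => ?_)
    simp only [Pi.add_apply, Real.norm_eq_abs]
    rw [abs_le]
    have h1 := hf (step H G S z).1
    have h2 := hup z
    constructor
    · linarith [neg_abs_le fstar, abs_nonneg (f S.1 + -H.γ * inner ℝ (gradient f S.1) (g z) +
        Lm / 2 * H.γ ^ 2 * ‖g z‖ ^ 2)]
    · linarith [abs_nonneg fstar, le_abs_self (f S.1 + -H.γ * inner ℝ (gradient f S.1) (g z) +
        Lm / 2 * H.γ ^ 2 * ‖g z‖ ^ 2)]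
  have fle : ∫ z, f (step H G S z).1 ∂(noiseLaw H d D) ≤
      f S.1 + H.γ * -inner ℝ (gradient f S.1) (meanEstimator H f S.2) +
      Lm / 2 * H.γ ^ 2 * momentEstimator H f σ S.2 := by
    refine (integral_mono fi (u3.add u2) hup).trans ?_
    simp only [Pi.add_apply]
    rw [integral_add u3 u2, integral_add (integrable_const _) u1, integral_const_mul,
      integral_const_mul, integral_inner hgi, hg.mean]
    simp only [integral_const, probReal_univ, smul_eq_mul, one_mul]
    have h1 := mul_le_mul_of_nonneg_left hg.sq
      (by have := A.Lm_nonneg; positivity : 0 ≤ Lm / 2 * H.γ ^ 2)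
    change _ ≤ _ * momentEstimator H f σ S.2 at h1
    linarith
  have fsi : Integrable (fun z => f (step H G S z).1 - fstar) (noiseLaw H d D) :=
    fi.sub (integrable_const _)
  refine ⟨fsi.add (vi.const_mul _), ?_⟩
  unfold lyapunov
  rw [integral_add fsi (vi.const_mul _), integral_sub fi (integrable_const _),
    integral_const_mul]
  simp only [integral_const, probReal_univ, smul_eq_mul, one_mul]
  have hin := A.neg_inner_le hLB hAB S
  have hvar := A.varEstimator_le hs S
  set Q := momentEstimator H f σ S.2 with hQ
  have hQ0 : 0 ≤ Q := add_nonneg (sq_nonneg _) (A.varEstimator_nonneg _)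
  have hγM : H.γ * M = 1 / 6 := by
    rw [A.γ_eq]
    field_simp
  have hc : Lm / 2 * H.γ ^ 2 * Q ≤ H.γ * Q / 12 := by
    have h1 : H.γ * Lm ≤ 1 / 6 := by
      rw [← hγM]
      exact mul_le_mul_of_nonneg_left A.Lm_le hγ.le
    have h2 := mul_le_mul_of_nonneg_right h1 (mul_nonneg hγ.le hQ0)
    linarith
  -- The factor `γ / (2p)` turns the contraction by `1 - p` into a gain of `γ/2` times `spread`,
  -- which pays for `neg_inner_le`; the added noise costs `(γ M)² = 1/36`.
  have hV : H.γ / (2 * H.p) * ∫ z, spread H Lm LA (step H G S z) ∂(noiseLaw H d D) ≤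
      H.γ / (2 * H.p) * spread H Lm LA S - H.γ / 2 * spread H Lm LA S + H.γ * Q / 36 := by
    refine (mul_le_mul_of_nonneg_left vle (by positivity)).trans ?_
    have e : H.γ / (2 * H.p) * ((1 - H.p) * (spread H Lm LA S +
        2 * H.p * M ^ 2 * (H.γ ^ 2 * Q))) =
        H.γ / (2 * H.p) * spread H Lm LA S - H.γ / 2 * spread H Lm LA S +
        (1 - H.p) * ((H.γ * M) ^ 2 * (H.γ * Q)) := by
      field_simp
    rw [e, hγM]
    nlinarith [mul_nonneg hγ.le hQ0]
  have hQle : Q ≤ ‖meanEstimator H f S.2‖ ^ 2 + (17 / 32 * ‖gradient f S.1‖ ^ 2 +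
      2 * (Lm ^ 2 * ∑ i, H.β i ^ 2 * (((d : ℝ) - 1) / H.m i) * ‖S.2 i - S.1‖ ^ 2) +
      17 / 64 * ε) := by
    rw [hQ, momentEstimator]
    linarith
  have hVa : 0 ≤ Lm ^ 2 * ∑ i, H.β i ^ 2 * (((d : ℝ) - 1) / H.m i) * ‖S.2 i - S.1‖ ^ 2 :=
    mul_nonneg (sq_nonneg _) (Finset.sum_nonneg fun i _ => by
      have := A.sub_one_nonneg
      positivity)
  have hsp : spread H Lm LA S = LA ^ 2 * ∑ i, H.β i * ‖S.2 i - S.1‖ ^ 2 +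
    Lm ^ 2 * ‖∑ i, H.β i • (S.2 i - S.1)‖ ^ 2 +
    Lm ^ 2 * ∑ i, H.β i ^ 2 * (((d : ℝ) - 1) / H.m i) * ‖S.2 i - S.1‖ ^ 2 := rfl
  -- The total coefficient of `Q` is `1/12 + 1/36 = 1/9`. What remains is `-1/2 + 17/288 ≤ -2/5` for
  -- the gradient, `-1/2 + 1/9 ≤ 0` for the mean estimator, `-1/2 + 2/9 ≤ 0` for the third part of
  -- `spread`, and `17/576 ≤ 3/100` for `ε`.
  have key : -inner ℝ (gradient f S.1) (meanEstimator H f S.2) + Q / 12 + Q / 36 -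
      spread H Lm LA S / 2 + 2 / 5 * ‖gradient f S.1‖ ^ 2 - 3 / 100 * ε ≤ 0 := by
    rw [hsp]
    linarith [hε, sq_nonneg ‖gradient f S.1‖, sq_nonneg ‖meanEstimator H f S.2‖]
  have key' := mul_nonpos_of_nonneg_of_nonpos hγ.le key
  linarith

lemma lyapunov_nonneg (A : H.Admissible d Lm LA σ ε M) {fstar : ℝ} (hf : ∀ x, fstar ≤ f x)
    (S : Vec d × (Fin n → Vec d)) : 0 ≤ lyapunov H Lm LA fstar f S := by
  have h1 := hf S.1
  have h2 := A.spread_nonneg S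
  have h3 := A.γ_pos
  have h4 := A.p_pos
  have : 0 ≤ H.γ / (2 * H.p) * spread H Lm LA S := by positivity
  unfold lyapunov
  linarith

lemma measurable_step (hG : Measurable fun q : Vec d × Ξ => G q.1 q.2) :
    Measurable fun q : (Vec d × (Fin n → Vec d)) × Noise H d Ξ => step H G q.1 q.2 := by
  have hg : Measurable fun q : (Vec d × (Fin n → Vec d)) × Noise H d Ξ =>
      q.1.1 - H.γ • gradEstimator H G q.1.2 q.2 := by
    have h1 : Measurable fun q : (Vec d × (Fin n → Vec d)) × Noise H d Ξ =>
        gradEstimator H G q.1.2 q.2 := by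
      have := (measurable_workerEstimator (H := H) hG).comp
        (g := fun s : (Fin n → Vec d) × (((i : Fin n) → Fin (H.b i) → Ξ) ×
          ((i : Fin n) → Fin (H.m i) → Fin d)) => workerEstimator H G s.1 s.2)
        (f := fun q : (Vec d × (Fin n → Vec d)) × Noise H d Ξ => (q.1.2, (q.2.1, q.2.2.1)))
        (by fun_prop)
      exact this
    exact (by fun_prop : Measurable fun q : (Vec d × (Fin n → Vec d)) × Noise H d Ξ =>
      q.1.1).sub (h1.fun_const_smul H.γ)
  refine hg.prodMk (measurable_pi_lambda _ fun i => ?_)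
  refine Measurable.ite ?_ hg (Measurable.add (by fun_prop) (Measurable.fun_const_smul
    (Finset.measurable_fun_sum _ fun j _ => ?_) _))
  · exact (by fun_prop : Measurable fun q : (Vec d × (Fin n → Vec d)) × Noise H d Ξ =>
      q.2.2.2.2) (measurableSet_singleton true)
  · exact measurable_rand1.comp (Measurable.prodMk (by fun_prop) (hg.sub (by fun_prop)))

lemma measurable_lyapunov (hs : IsLSmooth f Lm) (fstar : ℝ) :
    Measurable (lyapunov (n := n) H Lm LA fstar f) := by
  have := hs.1.continuous.measurable
  unfold lyapunov spread
  fun_prop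

end Lyapunov

/-! ### Convergence of the method -/

section Convergence

set_option linter.unusedSectionVars false

variable {n d : ℕ} {Ξ Ω : Type*} [MeasurableSpace Ξ] [MeasurableSpace Ω] {f : Vec d → ℝ}
  {G : Vec d → Ξ → Vec d} {D : Measure Ξ} {P : Measure Ω} {σ : ℝ} {H : Hyper n}
  {Lm LA ε M : ℝ} {x0 : Vec d} {ζ : ℕ → Ω → Noise H d Ξ}

/-- The `k`-th iterate uses only the draws with index below `k`, and is therefore independent of
draw `k`. -/
lemma exists_iterates_eq (hG : Measurable fun q : Vec d × Ξ => G q.1 q.2) (x0 : Vec d)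
    (ζ : ℕ → Ω → Noise H d Ξ) (k : ℕ) :
    ∃ F : (Finset.range k → Noise H d Ξ) → Vec d × (Fin n → Vec d), Measurable F ∧
      ∀ ω, iterates H G x0 ζ k ω = F fun i => ζ i ω := by
  induction k with
  | zero => exact ⟨fun _ => (x0, fun _ => x0), measurable_const, fun _ => rfl⟩
  | succ k ih =>
    obtain ⟨F, hF, he⟩ := ih
    refine ⟨fun u => step H G
      (F fun i => u ⟨i, Finset.mem_range.2 ((Finset.mem_range.1 i.2).trans (Nat.lt_succ_self k))⟩)
      (u ⟨k, Finset.self_mem_range_succ k⟩), ?_, fun ω => ?_⟩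
    · refine (measurable_step hG).comp (Measurable.prodMk (hF.comp ?_) (measurable_pi_apply _))
      exact measurable_pi_lambda _ fun i => measurable_pi_apply _
    · rw [iterates, he]

lemma measurable_iterates (hG : Measurable fun q : Vec d × Ξ => G q.1 q.2) (x0 : Vec d)
    (hζ : ∀ k, Measurable (ζ k)) (k : ℕ) : Measurable (iterates H G x0 ζ k) := by
  obtain ⟨F, hF, he⟩ := exists_iterates_eq hG x0 ζ k
  rw [funext he]
  exact hF.comp (measurable_pi_lambda _ fun i => hζ i)

lemma indepFun_iterates (hG : Measurable fun q : Vec d × Ξ => G q.1 q.2) (x0 : Vec d)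
    (hζ : IsNoiseSequence H D P ζ) (k : ℕ) : IndepFun (iterates H G x0 ζ k) (ζ k) P := by
  obtain ⟨F, hF, he⟩ := exists_iterates_eq hG x0 ζ k
  have h := hζ.2.2.indepFun_finset (Finset.range k) {k} (by simp) hζ.1
  have h2 := h.comp hF (measurable_pi_apply (⟨k, Finset.mem_singleton_self k⟩ : ({k} : Finset ℕ)))
  rw [funext he]
  exact h2

/-- By independence the joint law of iterate and draw is a product, so Tonelli averages the fresh
draw at a frozen state. -/
lemma lintegral_iterates_succ [IsProbabilityMeasure P]
    (hG : Measurable fun q : Vec d × Ξ => G q.1 q.2) (x0 : Vec d)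
    (hζ : IsNoiseSequence H D P ζ) (k : ℕ) {Ψ : Vec d × (Fin n → Vec d) → ENNReal}
    (hΨ : Measurable Ψ) :
    ∫⁻ ω, Ψ (iterates H G x0 ζ (k + 1) ω) ∂P =
      ∫⁻ ω, ∫⁻ z, Ψ (step H G (iterates H G x0 ζ k ω) z) ∂(noiseLaw H d D) ∂P := by
  have hm := measurable_iterates hG x0 hζ.1 k
  have hstep : Measurable fun q : (Vec d × (Fin n → Vec d)) × Noise H d Ξ =>
      Ψ (step H G q.1 q.2) := hΨ.comp (measurable_step hG)
  have hmap := (indepFun_iff_map_prod_eq_prod_map_map hm.aemeasurable (hζ.1 k).aemeasurable).1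
    (indepFun_iterates hG x0 hζ k)
  have : IsProbabilityMeasure (P.map (ζ k)) :=
    Measure.isProbabilityMeasure_map (hζ.1 k).aemeasurable
  calc ∫⁻ ω, Ψ (iterates H G x0 ζ (k + 1) ω) ∂P
      = ∫⁻ q, Ψ (step H G q.1 q.2)
          ∂(P.map fun ω => (iterates H G x0 ζ k ω, ζ k ω)) := by
        rw [lintegral_map hstep (hm.prodMk (hζ.1 k))]
        rfl
    _ = _ := by
        rw [hmap, lintegral_prod _ hstep.aemeasurable, hζ.2.1 k] at *
        exact lintegral_map (f := fun S => ∫⁻ z, Ψ (step H G S z) ∂(noiseLaw H d D))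
          hstep.lintegral_prod_right' hm

/-- Lower integrals need no integrability of the Lyapunov function along the iterates; integrability
of the gradients is read off at the end from the finite bound. -/
lemma lintegral_lyapunov_succ [IsProbabilityMeasure D] [IsProbabilityMeasure P]
    (A : H.Admissible d Lm LA σ ε M) {LB fstar : ℝ} (hLB : LB ≤ Lm) (hε : 0 ≤ ε)
    (h : IsStochasticGradient f G D σ) (hs : IsLSmooth f Lm) (hAB : FunctionalAB f LA LB)
    (hf : ∀ x, fstar ≤ f x) (hζ : IsNoiseSequence H D P ζ) (k : ℕ) :
    ∫⁻ ω, ENNReal.ofReal (lyapunov H Lm LA fstar f (iterates H G x0 ζ (k + 1) ω)) ∂P +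
      ∫⁻ ω, ENNReal.ofReal (2 / 5 * H.γ * ‖gradient f (iterates H G x0 ζ k ω).1‖ ^ 2) ∂P ≤
      ∫⁻ ω, ENNReal.ofReal (lyapunov H Lm LA fstar f (iterates H G x0 ζ k ω)) ∂P +
        ENNReal.ofReal (3 / 100 * H.γ * ε) := by
  have hm := measurable_iterates h.1 x0 hζ.1 k
  have hγ := A.γ_pos
  have hgm := hs.continuous_gradient.measurable
  have hlm := measurable_lyapunov (n := n) (H := H) (LA := LA) hs fstar
  rw [lintegral_iterates_succ h.1 x0 hζ k hlm.ennreal_ofReal,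
    ← lintegral_add_right _ (by fun_prop)]
  have hc : ENNReal.ofReal (3 / 100 * H.γ * ε) =
      ∫⁻ _ : Ω, ENNReal.ofReal (3 / 100 * H.γ * ε) ∂P := by simp
  rw [hc, ← lintegral_add_right _ measurable_const]
  refine lintegral_mono fun ω => ?_
  obtain ⟨hi, hle⟩ := integral_lyapunov_step A hLB hε h hs hAB hf (iterates H G x0 ζ k ω)
  rw [← ofReal_integral_eq_lintegral_ofReal hi (ae_of_all _ fun z => lyapunov_nonneg A hf _),
    ← ENNReal.ofReal_add (integral_nonneg fun z => lyapunov_nonneg A hf _) (by positivity),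
    ← ENNReal.ofReal_add (lyapunov_nonneg A hf _) (by positivity)]
  exact ENNReal.ofReal_le_ofReal hle

lemma lintegral_sum_gradient_le [IsProbabilityMeasure D] [IsProbabilityMeasure P]
    (A : H.Admissible d Lm LA σ ε M) {LB fstar : ℝ} (hLB : LB ≤ Lm) (hε : 0 ≤ ε)
    (h : IsStochasticGradient f G D σ) (hs : IsLSmooth f Lm) (hAB : FunctionalAB f LA LB)
    (hf : ∀ x, fstar ≤ f x) (hζ : IsNoiseSequence H D P ζ) (K : ℕ) :
    ∫⁻ ω, ENNReal.ofReal (lyapunov H Lm LA fstar f (iterates H G x0 ζ K ω)) ∂P +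
      ∑ k ∈ Finset.range K,
        ∫⁻ ω, ENNReal.ofReal (2 / 5 * H.γ * ‖gradient f (iterates H G x0 ζ k ω).1‖ ^ 2) ∂P ≤
      ENNReal.ofReal (f x0 - fstar) + K * ENNReal.ofReal (3 / 100 * H.γ * ε) := by
  induction K with
  -- All workers start at the server point, so the initial `spread` is zero.
  | zero => simp [iterates, lyapunov, spread]
  | succ K ih =>
    have h1 := lintegral_lyapunov_succ (x0 := x0) A hLB hε h hs hAB hf hζ K
    rw [Finset.sum_range_succ, add_comm (∑ k ∈ Finset.range K, _), ← add_assoc]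
    refine (add_le_add_left h1 _).trans ?_
    rw [add_right_comm]
    refine (add_le_add_left ih _).trans (le_of_eq ?_)
    push_cast
    ring

lemma integral_sum_gradient_le [IsProbabilityMeasure D] [IsProbabilityMeasure P]
    (A : H.Admissible d Lm LA σ ε M) {LB fstar : ℝ} (hLB : LB ≤ Lm) (hε : 0 ≤ ε)
    (h : IsStochasticGradient f G D σ) (hs : IsLSmooth f Lm) (hAB : FunctionalAB f LA LB)
    (hf : ∀ x, fstar ≤ f x) (hζ : IsNoiseSequence H D P ζ) (K : ℕ) :
    (∀ k < K, Integrable (fun ω => ‖gradient f (iterates H G x0 ζ k ω).1‖ ^ 2) P) ∧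
    2 / 5 * H.γ * ∑ k ∈ Finset.range K, ∫ ω, ‖gradient f (iterates H G x0 ζ k ω).1‖ ^ 2 ∂P ≤
      f x0 - fstar + K * (3 / 100 * H.γ * ε) := by
  have hγ := A.γ_pos
  have hx0 := hf x0
  have hgm := hs.continuous_gradient.measurable
  have h1 := le_trans le_add_self (lintegral_sum_gradient_le (x0 := x0) A hLB hε h hs hAB hf hζ K)
  rw [← ENNReal.ofReal_natCast, ← ENNReal.ofReal_mul (by positivity),
    ← ENNReal.ofReal_add (by linarith) (by positivity)] at h1
  have hi : ∀ k < K, Integrable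
      (fun ω => 2 / 5 * H.γ * ‖gradient f (iterates H G x0 ζ k ω).1‖ ^ 2) P := by
    intro k hk
    have hm := measurable_iterates h.1 x0 hζ.1 k
    have hmk : Measurable fun ω => 2 / 5 * H.γ * ‖gradient f (iterates H G x0 ζ k ω).1‖ ^ 2 := by
      fun_prop
    refine ⟨hmk.aestronglyMeasurable, ?_⟩
    rw [hasFiniteIntegral_iff_ofReal (ae_of_all _ fun ω => by positivity)]
    exact ((Finset.single_le_sum (f := fun k => ∫⁻ ω, ENNReal.ofReal
      (2 / 5 * H.γ * ‖gradient f (iterates H G x0 ζ k ω).1‖ ^ 2) ∂P) (fun _ _ => zero_le)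
      (Finset.mem_range.2 hk)).trans h1).trans_lt ENNReal.ofReal_lt_top
  have hc : 2 / 5 * H.γ ≠ 0 := by positivity
  refine ⟨fun k hk => (integrable_const_mul_iff hc.isUnit _).1 (hi k hk), ?_⟩
  rw [Finset.sum_congr rfl fun k hk => (ofReal_integral_eq_lintegral_ofReal
    (hi k (Finset.mem_range.1 hk)) (ae_of_all _ fun ω => by positivity)).symm,
    ← ENNReal.ofReal_sum_of_nonneg fun k _ => integral_nonneg fun ω => by positivity,
    ENNReal.ofReal_le_ofReal_iff (add_nonneg (by linarith) (by positivity))] at h1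
  rw [Finset.mul_sum]
  simpa only [integral_const_mul] using h1

lemma measurable_output (hG : Measurable fun q : Vec d × Ξ => G q.1 q.2) (x0 : Vec d)
    (hζ : ∀ k, Measurable (ζ k)) (N : ℕ) : Measurable (output H G x0 ζ N) :=
  measurable_from_prod_countable_left fun k : Fin (N + 1) =>
    (measurable_iterates hG x0 hζ k).fst

lemma isStationaryPoint_output [IsProbabilityMeasure D] [IsProbabilityMeasure P]
    (A : H.Admissible d Lm LA σ ε M) {LB fstar : ℝ} (hLB : LB ≤ Lm) (hε : 0 < ε)
    (h : IsStochasticGradient f G D σ) (hs : IsLSmooth f Lm) (hAB : FunctionalAB f LA LB)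
    (hf : ∀ x, fstar ≤ f x) (hζ : IsNoiseSequence H D P ζ) {N : ℕ}
    (hN : 48 * ((f x0 - fstar) / ε) * M ≤ N + 1) :
    IsStationaryPoint f ε (P.prod (uniformOn (Set.univ : Set (Fin (N + 1)))))
      (output H G x0 ζ N) := by
  have hgm := hs.continuous_gradient.measurable
  have hm := measurable_output h.1 x0 hζ.1 N
  obtain ⟨hi, hle⟩ := integral_sum_gradient_le (x0 := x0) A hLB hε.le h hs hAB hf hζ (N + 1)
  have hint : Integrable (fun q => ‖gradient f (output H G x0 ζ N q)‖ ^ 2)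
      (P.prod (uniformOn (Set.univ : Set (Fin (N + 1))))) := by
    refine (integrable_prod_iff' (by fun_prop : Measurable fun q =>
      ‖gradient f (output H G x0 ζ N q)‖ ^ 2).aestronglyMeasurable).2
      ⟨ae_of_all _ fun k => hi k k.2, Integrable.of_finite⟩
  refine ⟨hm, hint, ?_⟩
  rw [integral_prod_symm _ hint, integral_uniformOn_univ, Fintype.card_fin, smul_eq_mul]
  change 1 / ((N + 1 : ℕ) : ℝ) * ∑ k : Fin (N + 1),
    ∫ ω, ‖gradient f (iterates H G x0 ζ k ω).1‖ ^ 2 ∂P ≤ ε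
  rw [Fin.sum_univ_eq_sum_range
    (fun k => ∫ ω, ‖gradient f (iterates H G x0 ζ k ω).1‖ ^ 2 ∂P) (N + 1)]
  set s := ∑ k ∈ Finset.range (N + 1), ∫ ω, ‖gradient f (iterates H G x0 ζ k ω).1‖ ^ 2 ∂P
  have hM := A.M_pos
  have hN' : (0 : ℝ) < ((N + 1 : ℕ) : ℝ) := by positivity
  rw [one_div, inv_mul_le_iff₀ hN']
  rw [A.γ_eq] at hle
  have e : 2 / 5 * (1 / (6 * M)) * s * M = s / 15 := by
    field_simp
    ring
  have e2 : (f x0 - fstar + ((N + 1 : ℕ) : ℝ) * (3 / 100 * (1 / (6 * M)) * ε)) * M =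
      (f x0 - fstar) * M + ((N + 1 : ℕ) : ℝ) * ε / 200 := by
    field_simp
    ring
  have h1 := mul_le_mul_of_nonneg_right hle hM.le
  rw [e, e2] at h1
  -- With `K = N + 1` points, `s ≤ 15 Δ M + 15/200 K ε`, and the first term is at most `15/48 K ε`;
  -- together this stays below `K ε`.
  have h2 : 48 * ((f x0 - fstar) * M) ≤ ((N + 1 : ℕ) : ℝ) * ε := by
    have := mul_le_mul_of_nonneg_right hN hε.le
    push_cast
    calc _ = 48 * ((f x0 - fstar) / ε) * M * ε := by field_simp
      _ ≤ _ := this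
  have h3 : 0 < ((N + 1 : ℕ) : ℝ) * ε := by positivity
  linarith

lemma isStationaryPoint_of_gradient_eq_zero [IsProbabilityMeasure P]
    (hG : Measurable fun q : Vec d × Ξ => G q.1 q.2) (hζ : ∀ k, Measurable (ζ k)) (hε : 0 ≤ ε)
    (hf : ∀ x, gradient f x = 0) (N : ℕ) :
    IsStationaryPoint f ε (P.prod (uniformOn (Set.univ : Set (Fin (N + 1)))))
      (output H G x0 ζ N) :=
  ⟨measurable_output hG x0 hζ N, by simp [hf], by simpa [hf] using hε⟩

end Convergence

/-! ### Running time -/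

section Time

set_option linter.unusedSectionVars false

variable {n d : ℕ} {Ξ Ω : Type*} [MeasurableSpace Ξ] [MeasurableSpace Ω] {D : Measure Ξ}
  {P : Measure Ω} {H : Hyper n} {ζ : ℕ → Ω → Noise H d Ξ} {h τ κ : Fin n → ℝ}

lemma integral_coin [IsProbabilityMeasure D] (hd : 0 < d) (hp0 : 0 ≤ H.p) (hp1 : H.p ≤ 1)
    (hζ : IsNoiseSequence H D P ζ) (k : ℕ) (g : Bool → ℝ) :
    ∫ ω, g (ζ k ω).2.2.2 ∂P = H.p * g true + (1 - H.p) * g false := by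
  have : Nonempty (Fin d) := ⟨⟨0, hd⟩⟩
  have := isProbabilityMeasure_coinLaw hp0 hp1
  have h1 : MeasurePreserving (ζ k) P (noiseLaw H d D) := ⟨hζ.1 k, hζ.2.1 k⟩
  have h2 : MeasurePreserving (fun z : Noise H d Ξ => z.2.2.2) (noiseLaw H d D)
      (coinLaw H.p) :=
    (measurePreserving_snd.comp measurePreserving_snd).comp measurePreserving_snd
  have h3 := h2.comp h1
  rw [← integral_coinLaw hp0 hp1, ← h3.map_eq, integral_map h3.measurable.aemeasurable
    (measurable_of_finite g).aestronglyMeasurable]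
  rfl

lemma sum_range_le_of_mem_Icc {g : ℕ → ℝ} {c : ℝ} (hg : ∀ r, g r ∈ Set.Icc 0 c) (K : ℕ) :
    ∑ r ∈ Finset.range K, g r ≤ K * c := by
  have := Finset.sum_le_card_nsmul (Finset.range K) g c fun r _ => (hg r).2
  simpa using this

lemma measurable_iterationTime (T : Durations h τ κ Ω) (hζ : ∀ k, Measurable (ζ k)) (k : ℕ) :
    Measurable (iterationTime H T ζ k) := by
  refine Measurable.add (Measurable.add ?_ ?_) ?_
  · exact Measurable.iSup fun i => Finset.measurable_fun_sum _ fun r _ => T.measurable_comp k i r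
  · exact Measurable.iSup fun i => Finset.measurable_fun_sum _ fun r _ => T.measurable_up k i r
  · refine Measurable.iSup fun i => ?_
    have e : (fun ω => ∑ q ∈ Finset.range (if (ζ k ω).2.2.2 = true then d else H.l i),
        T.down k i q ω) = fun ω => if (ζ k ω).2.2.2 = true then
          ∑ q ∈ Finset.range d, T.down k i q ω else
          ∑ q ∈ Finset.range (H.l i), T.down k i q ω := by
      funext ω
      split_ifs <;> rfl
    rw [e]
    refine Measurable.ite ?_ (Finset.measurable_fun_sum _ fun r _ => T.measurable_down k i r)
      (Finset.measurable_fun_sum _ fun r _ => T.measurable_down k i r)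
    exact (hζ k).snd.snd.snd (measurableSet_singleton true)

lemma le_kappaMax (κ : Fin n → ℝ) (i : Fin n) : κ i ≤ kappaMax κ :=
  le_ciSup (Set.finite_range κ).bddAbove i

lemma iterationTime_mem (hn : 0 < n) (T : Durations h τ κ Ω) {t : ℝ}
    (hb : ∀ i, H.b i * h i ≤ t) (hm : ∀ i, H.m i * τ i ≤ t) (hl : ∀ i, H.l i * κ i ≤ t)
    (ht : 0 ≤ t) (k : ℕ) (ω : Ω) :
    0 ≤ iterationTime H T ζ k ω ∧ iterationTime H T ζ k ω ≤
      3 * t + if (ζ k ω).2.2.2 = true then d * kappaMax κ else 0 := by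
  have : Nonempty (Fin n) := ⟨⟨0, hn⟩⟩
  constructor
  · refine add_nonneg (add_nonneg ?_ ?_) ?_
    · exact Real.iSup_nonneg fun i => Finset.sum_nonneg fun r _ => (T.comp_mem k i r ω).1
    · exact Real.iSup_nonneg fun i => Finset.sum_nonneg fun r _ => (T.up_mem k i r ω).1
    · exact Real.iSup_nonneg fun i => Finset.sum_nonneg fun r _ => (T.down_mem k i r ω).1
  · have h1 : (⨆ i, ∑ r ∈ Finset.range (H.b i), T.comp k i r ω) ≤ t := ciSup_le fun i =>
      (sum_range_le_of_mem_Icc (fun r => T.comp_mem k i r ω) _).trans (hb i)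
    have h2 : (⨆ i, ∑ r ∈ Finset.range (H.m i), T.up k i r ω) ≤ t := ciSup_le fun i =>
      (sum_range_le_of_mem_Icc (fun r => T.up_mem k i r ω) _).trans (hm i)
    have h3 : (⨆ i, ∑ q ∈ Finset.range (if (ζ k ω).2.2.2 = true then d else H.l i),
        T.down k i q ω) ≤ t + if (ζ k ω).2.2.2 = true then d * kappaMax κ else 0 := by
      refine ciSup_le fun i =>
        (sum_range_le_of_mem_Icc (fun r => T.down_mem k i r ω) _).trans ?_
      split_ifs
      · have := mul_le_mul_of_nonneg_left (le_kappaMax κ i) (Nat.cast_nonneg (α := ℝ) d)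
        linarith
      · linarith [hl i]
    unfold iterationTime
    linarith

/-- The three phases take at most `3t`, apart from at most `d κ_max` more at a synchronization,
which costs at most `t` on average. The bound is pointwise in the coin, so the durations may depend
on the draws. -/
lemma integral_totalTime_le [IsProbabilityMeasure D] [IsProbabilityMeasure P] (hn : 0 < n)
    (hd : 0 < d) (hp0 : 0 ≤ H.p) (hp1 : H.p ≤ 1) (hζ : IsNoiseSequence H D P ζ)
    (T : Durations h τ κ Ω) {t : ℝ}
    (hb : ∀ i, H.b i * h i ≤ t) (hm : ∀ i, H.m i * τ i ≤ t) (hl : ∀ i, H.l i * κ i ≤ t)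
    (ht : 0 ≤ t) (hκ : 0 ≤ kappaMax κ) (hp : H.p * (d * kappaMax κ) ≤ t) (N : ℕ) :
    Integrable (totalTime H T ζ N) P ∧ ∫ ω, totalTime H T ζ N ω ∂P ≤ N * (4 * t) := by
  have hmem := iterationTime_mem (ζ := ζ) hn T hb hm hl ht
  have hci : ∀ k, Integrable (fun ω => 3 * t +
      if (ζ k ω).2.2.2 = true then d * kappaMax κ else 0) P := by
    intro k
    refine (integrable_const (3 * t + d * kappaMax κ)).mono' ?_ (ae_of_all _ fun ω => ?_)
    · exact (Measurable.const_add (Measurable.ite ((hζ.1 k).snd.snd.snd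
        (measurableSet_singleton true)) measurable_const measurable_const)
        _).aestronglyMeasurable
    · have : 0 ≤ (d : ℝ) * kappaMax κ := by positivity
      rw [Real.norm_eq_abs, abs_le]
      split_ifs <;> constructor <;> linarith
  have hii : ∀ k, Integrable (iterationTime H T ζ k) P := fun k =>
    (hci k).mono' (measurable_iterationTime T hζ.1 k).aestronglyMeasurable
      (ae_of_all _ fun ω => by
        rw [Real.norm_of_nonneg (hmem k ω).1]
        exact (hmem k ω).2)
  refine ⟨integrable_finsetSum _ fun k _ => hii k, ?_⟩
  unfold totalTime
  rw [integral_finsetSum _ fun k _ => hii k]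
  have := Finset.sum_le_card_nsmul (Finset.range N)
    (fun k => ∫ ω, iterationTime H T ζ k ω ∂P) (4 * t) fun k _ => ?_
  · simpa using this
  · refine (integral_mono (hii k) (hci k) fun ω => (hmem k ω).2).trans ?_
    rw [integral_coin hd hp0 hp1 hζ k
      fun c => 3 * t + if c = true then d * kappaMax κ else 0]
    simp only [if_true, Bool.false_eq_true, if_false]
    linarith

end Time

/-! ### The equilibrium equation -/

/-- A denominator in the equilibrium equation, for a worker with durations `h`, `τ`, `κ`. -/
def eqDenom (d : ℕ) (ω σ ε km h τ κ s : ℝ) : ℝ :=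
  16 * ω * τ / s + 16 * σ ^ 2 * h / (ε * s) + 32 * σ ^ 2 * ω * h * τ / (ε * s ^ 2)
    + 4 * d * ω * km * κ / s ^ 2 + 8 * d * ω * ω * km * κ * τ / s ^ 3

section Equilibrium

variable {d : ℕ} {ω σ ε km h τ κ : ℝ}

/-- The only term that survives for `d = 1`, where `ω = 0`. It keeps the denominators positive and
makes them blow up as `s → 0`. -/
lemma le_eqDenom (hω : 0 ≤ ω) (hε : 0 < ε) (hkm : 0 ≤ km) (hh : 0 < h)
    (hτ : 0 < τ) (hκ : 0 < κ) {s : ℝ} (hs : 0 < s) :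
    16 * σ ^ 2 * h / ε / s ≤ eqDenom d ω σ ε km h τ κ s := by
  unfold eqDenom
  rw [div_div]
  have h1 : 0 ≤ 16 * ω * τ / s := by positivity
  have h2 : 0 ≤ 32 * σ ^ 2 * ω * h * τ / (ε * s ^ 2) := by positivity
  have h3 : 0 ≤ 4 * d * ω * km * κ / s ^ 2 := by positivity
  have h4 : 0 ≤ 8 * d * ω * ω * km * κ * τ / s ^ 3 := by positivity
  linarith

lemma eqDenom_pos (hω : 0 ≤ ω) (hσ : 0 < σ) (hε : 0 < ε) (hkm : 0 ≤ km) (hh : 0 < h)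
    (hτ : 0 < τ) (hκ : 0 < κ) {s : ℝ} (hs : 0 < s) : 0 < eqDenom d ω σ ε km h τ κ s :=
  (by positivity : 0 < 16 * σ ^ 2 * h / ε / s).trans_le (le_eqDenom hω hε hkm hh hτ hκ hs)

lemma eqDenom_mono (hω : 0 ≤ ω) (hε : 0 < ε) (hkm : 0 ≤ km) (hh : 0 < h)
    (hτ : 0 < τ) (hκ : 0 < κ) {s t : ℝ} (hs : 0 < s) (hst : s ≤ t) :
    eqDenom d ω σ ε km h τ κ t ≤ eqDenom d ω σ ε km h τ κ s := by
  unfold eqDenom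
  gcongr

lemma eqDenom_strict (hω : 0 ≤ ω) (hσ : 0 < σ) (hε : 0 < ε) (hkm : 0 ≤ km) (hh : 0 < h)
    (hτ : 0 < τ) (hκ : 0 < κ) {s t : ℝ} (hs : 0 < s) (hst : s < t) :
    eqDenom d ω σ ε km h τ κ t < eqDenom d ω σ ε km h τ κ s := by
  have h0 : 16 * σ ^ 2 * h / (ε * t) < 16 * σ ^ 2 * h / (ε * s) := by gcongr
  have h1 : 16 * ω * τ / t ≤ 16 * ω * τ / s := by gcongr
  have h2 : 32 * σ ^ 2 * ω * h * τ / (ε * t ^ 2) ≤ 32 * σ ^ 2 * ω * h * τ / (ε * s ^ 2) := by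
    gcongr
  have h3 : 4 * d * ω * km * κ / t ^ 2 ≤ 4 * d * ω * km * κ / s ^ 2 := by gcongr
  have h4 : 8 * d * ω * ω * km * κ * τ / t ^ 3 ≤ 8 * d * ω * ω * km * κ * τ / s ^ 3 := by gcongr
  unfold eqDenom
  linarith

lemma continuousOn_eqDenom (hε : 0 < ε) :
    ContinuousOn (eqDenom d ω σ ε km h τ κ) (Set.Ioi 0) := by
  intro s hs
  have hs' : s ≠ 0 := (Set.mem_Ioi.1 hs).ne'
  have h1 : ε * s ≠ 0 := by positivity
  have h2 : ε * s ^ 2 ≠ 0 := by positivity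
  have h3 : s ^ 2 ≠ 0 := by positivity
  have h4 : s ^ 3 ≠ 0 := by positivity
  refine ContinuousAt.continuousWithinAt ?_
  unfold eqDenom
  fun_prop (disch := assumption)

lemma exists_eqDenom_le_one (hω : 0 ≤ ω) (hε : 0 < ε) (hkm : 0 ≤ km) (hh : 0 < h)
    (hτ : 0 < τ) (hκ : 0 < κ) (s₀ : ℝ) : ∃ s, s₀ ≤ s ∧ 0 < s ∧ eqDenom d ω σ ε km h τ κ s ≤ 1 := by
  set C := 16 * ω * τ + 16 * σ ^ 2 * h / ε + 32 * σ ^ 2 * ω * h * τ / ε + 4 * d * ω * km * κ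
    + 8 * d * ω * ω * km * κ * τ with hC
  have hC0 : 0 ≤ C := by positivity
  obtain ⟨s, h1, h2, h3⟩ : ∃ s : ℝ, s₀ ≤ s ∧ 1 ≤ s ∧ C ≤ s :=
    ⟨max s₀ (max 1 C), le_max_left _ _, (le_max_left _ _).trans (le_max_right _ _),
      (le_max_right _ _).trans (le_max_right _ _)⟩
  have hs : 0 < s := by linarith
  refine ⟨s, h1, hs, ?_⟩
  have k2 : s ≤ s ^ 2 := by nlinarith
  have k3 : s ≤ s ^ 3 := by nlinarith
  have e1 : 16 * σ ^ 2 * h / (ε * s) = 16 * σ ^ 2 * h / ε / s := by rw [div_div]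
  have e2 : 32 * σ ^ 2 * ω * h * τ / (ε * s ^ 2) ≤ 32 * σ ^ 2 * ω * h * τ / ε / s := by
    rw [div_div]
    gcongr
  have e3 : 4 * d * ω * km * κ / s ^ 2 ≤ 4 * d * ω * km * κ / s := by gcongr
  have e4 : 8 * d * ω * ω * km * κ * τ / s ^ 3 ≤ 8 * d * ω * ω * km * κ * τ / s := by gcongr
  have e5 : C / s ≤ 1 := (div_le_one hs).2 h3
  rw [hC, add_div, add_div, add_div, add_div] at e5
  unfold eqDenom
  linarith

end Equilibrium

/-! ### Existence and uniqueness of the equilibrium time -/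

section EquilibriumTime

variable {n d : ℕ} {ω σ ε : ℝ} {h τ κ : Fin n → ℝ}

lemma kappaMax_pos (hn : 0 < n) (hκ : ∀ i, 0 < κ i) : 0 < kappaMax κ :=
  (hκ ⟨0, hn⟩).trans_le (le_kappaMax κ _)

lemma isEquilibriumTime_iff {s : ℝ} : IsEquilibriumTime d ω ω σ ε h τ κ s ↔
    0 < s ∧ ∑ i, 1 / eqDenom d ω σ ε (kappaMax κ) (h i) (τ i) (κ i) s = 1 := by
  unfold IsEquilibriumTime eqDenom
  rw [inv_eq_one]

/-- The sum of reciprocals `F` is continuous and strictly increasing on the positive reals, so the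
intermediate value theorem applies once `F` is at most 1 somewhere and at least 1 further right. -/
theorem existsUnique_isEquilibriumTime (hn : 0 < n) (hω : 0 ≤ ω) (hσ : 0 < σ) (hε : 0 < ε)
    (hh : ∀ i, 0 < h i) (hτ : ∀ i, 0 < τ i) (hκ : ∀ i, 0 < κ i) :
    ∃! s : ℝ, IsEquilibriumTime d ω ω σ ε h τ κ s := by
  have hkm := (kappaMax_pos hn hκ).le
  have : Nonempty (Fin n) := ⟨⟨0, hn⟩⟩
  set F : ℝ → ℝ := fun s => ∑ i, 1 / eqDenom d ω σ ε (kappaMax κ) (h i) (τ i) (κ i) s with hF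
  have hpos : ∀ i, ∀ s : ℝ, 0 < s → 0 < eqDenom d ω σ ε (kappaMax κ) (h i) (τ i) (κ i) s :=
    fun i s hs => eqDenom_pos hω hσ hε hkm (hh i) (hτ i) (hκ i) hs
  have hmono : StrictMonoOn F (Set.Ioi 0) := by
    intro s hs t ht hst
    refine Finset.sum_lt_sum_of_nonempty Finset.univ_nonempty fun i _ => ?_
    exact one_div_lt_one_div_of_lt (hpos i t ht)
      (eqDenom_strict hω hσ hε hkm (hh i) (hτ i) (hκ i) hs hst)
  have hcont : ContinuousOn F (Set.Ioi 0) := continuousOn_finsetSum _ fun i _ =>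
    continuousOn_const.div (continuousOn_eqDenom hε) fun s hs => (hpos i s hs).ne'
  -- `F s ≤ c * s` by `le_eqDenom`, hence `F (1 / c) ≤ 1`.
  set c : ℝ := ∑ i, 1 / (16 * σ ^ 2 * h i / ε) with hc
  have hc0 : 0 < c := Finset.sum_pos (fun i _ => by
    have := hh i
    positivity) Finset.univ_nonempty
  have h1 : F (1 / c) ≤ 1 := by
    have hs : 0 < 1 / c := by positivity
    calc F (1 / c) ≤ ∑ i, 1 / c * (1 / (16 * σ ^ 2 * h i / ε)) := by
          refine Finset.sum_le_sum fun i _ => ?_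
          have := hh i
          have hle := one_div_le_one_div_of_le (by positivity)
            (le_eqDenom (d := d) (σ := σ) hω hε hkm (hh i) (hτ i) (hκ i) hs)
          refine hle.trans (le_of_eq ?_)
          rw [one_div_div, div_eq_mul_one_div]
      _ = 1 := by
          rw [← Finset.mul_sum, ← hc, one_div_mul_cancel hc0.ne']
  obtain ⟨s, hs1, hs0, hs2⟩ := exists_eqDenom_le_one (d := d) (σ := σ) hω hε hkm (hh ⟨0, hn⟩)
    (hτ ⟨0, hn⟩) (hκ ⟨0, hn⟩) (1 / c)
  have h2 : 1 ≤ F s := by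
    refine le_trans ?_ (Finset.single_le_sum (fun i _ => (one_div_pos.2 (hpos i s hs0)).le)
      (Finset.mem_univ (⟨0, hn⟩ : Fin n)))
    exact (one_le_div (hpos _ s hs0)).2 hs2
  have hsub : Set.Icc (1 / c) s ⊆ Set.Ioi 0 := fun r hr =>
    (by positivity : 0 < 1 / c).trans_le hr.1
  obtain ⟨r, hr, hr1⟩ := intermediate_value_Icc hs1 (hcont.mono hsub) ⟨h1, h2⟩
  refine ⟨r, isEquilibriumTime_iff.2 ⟨hsub hr, hr1⟩, fun r' hr' => ?_⟩
  obtain ⟨h3, h4⟩ := isEquilibriumTime_iff.1 hr'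
  exact hmono.injOn h3 (hsub hr) (h4.trans hr1.symm)

end EquilibriumTime

/-! ### The parameters for a time budget -/

lemma floor_pos_of_one_le {x : ℝ} (hx : 1 ≤ x) : 0 < ⌊x⌋₊ := Nat.floor_pos.2 hx

/-- For `x ≥ 1` one has `x < ⌊x⌋ + 1 ≤ 2⌊x⌋`. -/
lemma one_div_floor_le {t a : ℝ} (ha : 0 < a) (hat : a ≤ t) :
    1 / (⌊t / a⌋₊ : ℝ) ≤ 2 * a / t := by
  have ht : 0 < t := ha.trans_le hat
  have h1 : 1 ≤ t / a := (one_le_div ha).2 hat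
  have h2 : (1 : ℝ) ≤ ⌊t / a⌋₊ := by exact_mod_cast floor_pos_of_one_le h1
  have h3 := Nat.lt_floor_add_one (t / a)
  have h4 : t / a ≤ 2 * ⌊t / a⌋₊ := by linarith
  rw [div_le_iff₀ ha] at h4
  rw [div_le_div_iff₀ (by linarith) ht]
  linarith

lemma floor_mul_le {t a : ℝ} (ha : 0 < a) (ht : 0 ≤ t) : (⌊t / a⌋₊ : ℝ) * a ≤ t :=
  (le_div_iff₀ ha).1 (Nat.floor_le (by positivity))

/-- The reciprocal of `rawWeight`, when both compressors have variance parameter `ω`. -/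
def invWeight (ω σ ε p : ℝ) (b m l : ℕ) : ℝ :=
  8 * ω * (1 / m) + 8 * (σ ^ 2 / ε) * ω * (1 / b) * (1 / m) + 8 * (σ ^ 2 / ε) * (1 / b)
    + ω ^ 2 * (1 / p) * (1 / m) * (1 / l) + ω * (1 / p) * (1 / l)

lemma rawWeight_eq (ω σ ε p : ℝ) (b m l : ℕ) :
    rawWeight ω ω σ ε p b m l = (invWeight ω σ ε p b m l)⁻¹ := by
  unfold rawWeight invWeight
  congr 1
  simp only [div_eq_mul_inv, mul_inv]
  ring

section Weight

variable {d : ℕ} {ω σ ε p km h τ κ t : ℝ} {b m l : ℕ}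

lemma invWeight_pos (hω : 0 ≤ ω) (hσ : 0 < σ) (hε : 0 < ε) (hp : 0 < p) (hb : 0 < b) :
    0 < invWeight ω σ ε p b m l := by
  have hb' : (0 : ℝ) < b := by exact_mod_cast hb
  unfold invWeight
  positivity

/-- `eqDenom` is `invWeight` with each reciprocal replaced by its rounding bound; this explains its
constants 16, 32, 4 and 8. -/
lemma invWeight_le (hω : 0 ≤ ω) (hε : 0 < ε) (hp : 0 < p) (hkm : 0 ≤ km) (hh : 0 < h)
    (hτ : 0 < τ) (hκ : 0 < κ) (ht : 0 < t) (hb : 1 / (b : ℝ) ≤ 2 * h / t)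
    (hm : 1 / (m : ℝ) ≤ 2 * τ / t) (hl : 1 / (l : ℝ) ≤ 2 * κ / t)
    (hp' : 1 / p ≤ d * (2 * km / t)) :
    invWeight ω σ ε p b m l ≤ eqDenom d ω σ ε km h τ κ t := by
  have e : eqDenom d ω σ ε km h τ κ t =
      8 * ω * (2 * τ / t) + 8 * (σ ^ 2 / ε) * ω * (2 * h / t) * (2 * τ / t)
      + 8 * (σ ^ 2 / ε) * (2 * h / t) + ω ^ 2 * (d * (2 * km / t)) * (2 * τ / t) * (2 * κ / t)
      + ω * (d * (2 * km / t)) * (2 * κ / t) := by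
    unfold eqDenom
    field_simp
    ring
  rw [e]
  unfold invWeight
  gcongr

/-- For `p = 1` and `ω / l ≤ 1` the two broadcast terms are at most `ω / m`, an eighth of a term
already bounded by `eqDenom`, and 1. -/
lemma invWeight_le_of_eq_one (hω : 0 ≤ ω) (hε : 0 < ε) (hkm : 0 ≤ km) (hh : 0 < h)
    (hτ : 0 < τ) (hκ : 0 < κ) (ht : 0 < t) (hb : 1 / (b : ℝ) ≤ 2 * h / t)
    (hm : 1 / (m : ℝ) ≤ 2 * τ / t) (hl : ω * (1 / (l : ℝ)) ≤ 1) :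
    invWeight ω σ ε 1 b m l ≤ 9 / 8 * eqDenom d ω σ ε km h τ κ t + 1 := by
  have e : 8 * ω * (2 * τ / t) + 8 * (σ ^ 2 / ε) * ω * (2 * h / t) * (2 * τ / t)
      + 8 * (σ ^ 2 / ε) * (2 * h / t) ≤ eqDenom d ω σ ε km h τ κ t := by
    have h3 : 0 ≤ 4 * d * ω * km * κ / t ^ 2 := by positivity
    have h4 : 0 ≤ 8 * d * ω * ω * km * κ * τ / t ^ 3 := by positivity
    have e' : 8 * ω * (2 * τ / t) + 8 * (σ ^ 2 / ε) * ω * (2 * h / t) * (2 * τ / t)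
      + 8 * (σ ^ 2 / ε) * (2 * h / t) = 16 * ω * τ / t + 16 * σ ^ 2 * h / (ε * t) +
        32 * σ ^ 2 * ω * h * τ / (ε * t ^ 2) := by
      field_simp
      ring
    unfold eqDenom
    linarith
  have e1 : 8 * ω * (1 / (m : ℝ)) + 8 * (σ ^ 2 / ε) * ω * (1 / b) * (1 / m) +
      8 * (σ ^ 2 / ε) * (1 / b) ≤ eqDenom d ω σ ε km h τ κ t := by
    refine le_trans ?_ e
    gcongr
  have e2 : 0 ≤ 8 * (σ ^ 2 / ε) * ω * (1 / (b : ℝ)) * (1 / m) +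
      8 * (σ ^ 2 / ε) * (1 / (b : ℝ)) := by positivity
  have e3 := mul_le_mul_of_nonneg_left hl (by positivity : 0 ≤ ω * (1 / (m : ℝ)))
  have e4 : ω ^ 2 * (1 / 1) * (1 / (m : ℝ)) * (1 / l) = ω * (1 / m) * (ω * (1 / l)) := by ring
  have e5 : ω * (1 / 1) * (1 / (l : ℝ)) = ω * (1 / l) := by ring
  unfold invWeight
  rw [e4, e5]
  linarith

end Weight

/-- Either some `D i < 1`, and that term alone exceeds `8/17`, or all `D i ≥ 1`, and then `9/8 * D i
+ 1 ≤ 17/8 * D i`. -/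
lemma sum_one_div_affine_ge {n : ℕ} {D : Fin n → ℝ} (hD : ∀ i, 0 < D i)
    (hsum : 1 ≤ ∑ i, 1 / D i) : 8 / 17 ≤ ∑ i, 1 / (9 / 8 * D i + 1) := by
  have hnn : ∀ i, 0 ≤ 1 / (9 / 8 * D i + 1) := fun i => by
    have := hD i
    positivity
  by_cases hex : ∃ i, D i < 1
  · obtain ⟨i, hi⟩ := hex
    refine le_trans ?_ (Finset.single_le_sum (fun i _ => hnn i) (Finset.mem_univ i))
    rw [div_le_div_iff₀ (by norm_num) (by linarith [hD i])]
    linarith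
  · push Not at hex
    calc (8 : ℝ) / 17 ≤ 8 / 17 * ∑ i, 1 / D i := by linarith
      _ ≤ _ := by
        rw [Finset.mul_sum]
        refine Finset.sum_le_sum fun i _ => ?_
        have := hD i
        rw [div_mul_div_comm, div_le_div_iff₀ (by positivity) (by positivity)]
        linarith [hex i]

section Budget

variable {n d : ℕ} {ω σ ε : ℝ} {h τ κ : Fin n → ℝ} {t s : ℝ}

lemma le_timeBudget (h τ κ : Fin n → ℝ) (s : ℝ) (i : Fin n) :
    h i ≤ timeBudget h τ κ s ∧ τ i ≤ timeBudget h τ κ s ∧ κ i ≤ timeBudget h τ κ s := by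
  have h1 : max (h i) (max (τ i) (κ i)) ≤ timeBudget h τ κ s :=
    (le_ciSup (f := fun i => max (h i) (max (τ i) (κ i))) (Set.finite_range _).bddAbove i).trans
      (le_max_left _ _)
  exact ⟨(le_max_left _ _).trans h1, ((le_max_left _ _).trans (le_max_right _ _)).trans h1,
    ((le_max_right _ _).trans (le_max_right _ _)).trans h1⟩

lemma kappaMax_le (hn : 0 < n) (hκt : ∀ i, κ i ≤ t) : kappaMax κ ≤ t :=
  have : Nonempty (Fin n) := ⟨⟨0, hn⟩⟩
  ciSup_le hκt

lemma syncProb_pos (hn : 0 < n) (hd : 0 < d) (hκ : ∀ i, 0 < κ i) (hκt : ∀ i, κ i ≤ t) :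
    0 < syncProb d κ t := by
  have h1 := floor_pos_of_one_le ((one_le_div (kappaMax_pos hn hκ)).2 (kappaMax_le hn hκt))
  unfold syncProb
  positivity

lemma syncProb_le_one : syncProb d κ t ≤ 1 := min_le_right _ _

lemma syncProb_mul_le (hn : 0 < n) (hd : 0 < d) (hκ : ∀ i, 0 < κ i) (ht : 0 ≤ t) :
    syncProb d κ t * (d * kappaMax κ) ≤ t := by
  have hkm := kappaMax_pos hn hκ
  have hd' : (0 : ℝ) < d := by exact_mod_cast hd
  calc syncProb d κ t * (d * kappaMax κ)
      ≤ (⌊t / kappaMax κ⌋₊ : ℝ) / d * (d * kappaMax κ) := by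
        gcongr
        exact min_le_left _ _
    _ = ⌊t / kappaMax κ⌋₊ * kappaMax κ := by field_simp
    _ ≤ t := floor_mul_le hkm ht

/-- Either `p` is the rounded ratio, or `⌊t / κ_max⌋ ≥ d`; then every worker can receive at least
`d` coordinates within the budget. -/
lemma syncProb_cases (hn : 0 < n) (hd : 0 < d) (hκ : ∀ i, 0 < κ i) (hκt : ∀ i, κ i ≤ t) :
    1 / syncProb d κ t ≤ d * (2 * kappaMax κ / t) ∨
      (syncProb d κ t = 1 ∧ ∀ i, ((d : ℝ) - 1) * (1 / (⌊t / κ i⌋₊ : ℝ)) ≤ 1) := by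
  have hkm := kappaMax_pos hn hκ
  have hkt := kappaMax_le hn hκt
  have hd' : (0 : ℝ) < d := by exact_mod_cast hd
  rcases le_total ((⌊t / kappaMax κ⌋₊ : ℝ) / d) 1 with hle | hle
  · left
    rw [syncProb, min_eq_left hle, one_div_div, div_eq_mul_one_div]
    have := one_div_floor_le hkm hkt
    gcongr
  · right
    refine ⟨min_eq_right hle, fun i => ?_⟩
    rw [one_le_div hd'] at hle
    have h1 : (⌊t / kappaMax κ⌋₊ : ℝ) ≤ ⌊t / κ i⌋₊ := by
      have ht : 0 ≤ t := (hkm.trans_le hkt).le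
      have := hκ i
      have := le_kappaMax κ i
      exact_mod_cast Nat.floor_le_floor (by gcongr)
    rw [mul_one_div, div_le_one (by linarith)]
    linarith

/-- A time budget that is at least the solution of the equilibrium equation and all durations. -/
structure IsBudget (d : ℕ) (ω σ ε : ℝ) (h τ κ : Fin n → ℝ) (t : ℝ) : Prop where
  n_pos : 0 < n
  d_pos : 0 < d
  ω_eq : ω = (d : ℝ) - 1
  σ_pos : 0 < σ
  ε_pos : 0 < ε
  h_pos : ∀ i, 0 < h i
  τ_pos : ∀ i, 0 < τ i
  κ_pos : ∀ i, 0 < κ i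
  h_le : ∀ i, h i ≤ t
  τ_le : ∀ i, τ i ≤ t
  κ_le : ∀ i, κ i ≤ t
  one_le : 1 ≤ ∑ i, 1 / eqDenom d ω σ ε (kappaMax κ) (h i) (τ i) (κ i) t

lemma IsBudget.t_pos (B : IsBudget d ω σ ε h τ κ t) : 0 < t :=
  (B.h_pos ⟨0, B.n_pos⟩).trans_le (B.h_le _)

lemma IsBudget.ω_nonneg (B : IsBudget d ω σ ε h τ κ t) : 0 ≤ ω := by
  have : (1 : ℝ) ≤ d := by exact_mod_cast B.d_pos
  rw [B.ω_eq]
  linarith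

lemma isBudget_timeBudget (hn : 0 < n) (hd : 0 < d) (hω : ω = (d : ℝ) - 1) (hσ : 0 < σ)
    (hε : 0 < ε) (hh : ∀ i, 0 < h i) (hτ : ∀ i, 0 < τ i) (hκ : ∀ i, 0 < κ i)
    (hs : IsEquilibriumTime d ω ω σ ε h τ κ s) :
    IsBudget d ω σ ε h τ κ (timeBudget h τ κ s) := by
  refine ⟨hn, hd, hω, hσ, hε, hh, hτ, hκ, fun i => (le_timeBudget h τ κ s i).1,
    fun i => (le_timeBudget h τ κ s i).2.1, fun i => (le_timeBudget h τ κ s i).2.2, ?_⟩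
  have hω0 : 0 ≤ ω := by
    have : (1 : ℝ) ≤ d := by exact_mod_cast hd
    linarith
  have hkm := (kappaMax_pos hn hκ).le
  obtain ⟨hs0, hs1⟩ := isEquilibriumTime_iff.1 hs
  have hst : s ≤ timeBudget h τ κ s := le_max_right _ _
  refine hs1.symm.le.trans <| Finset.sum_le_sum fun i _ => one_div_le_one_div_of_le
    (eqDenom_pos hω0 hσ hε hkm (hh i) (hτ i) (hκ i) (hs0.trans_le hst))
    (eqDenom_mono hω0 hε hkm (hh i) (hτ i) (hκ i) hs0 hst)

/-- The reciprocals of the weights of the workers for the time budget `t`. -/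
def budgetInvWeight (d : ℕ) (ω σ ε : ℝ) (h τ κ : Fin n → ℝ) (t : ℝ) (i : Fin n) : ℝ :=
  invWeight ω σ ε (syncProb d κ t) ⌊t / h i⌋₊ ⌊t / τ i⌋₊ ⌊t / κ i⌋₊

lemma IsBudget.invWeight_pos (B : IsBudget d ω σ ε h τ κ t) (i : Fin n) :
    0 < budgetInvWeight d ω σ ε h τ κ t i :=
  Inkheart.invWeight_pos B.ω_nonneg B.σ_pos B.ε_pos (syncProb_pos B.n_pos B.d_pos B.κ_pos B.κ_le)
    (floor_pos_of_one_le ((one_le_div (B.h_pos i)).2 (B.h_le i)))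

lemma IsBudget.sum_weight_ge (B : IsBudget d ω σ ε h τ κ t) :
    8 / 17 ≤ ∑ i, (budgetInvWeight d ω σ ε h τ κ t i)⁻¹ := by
  have hkm := (kappaMax_pos B.n_pos B.κ_pos).le
  have hb := fun i => one_div_floor_le (B.h_pos i) (B.h_le i)
  have hm := fun i => one_div_floor_le (B.τ_pos i) (B.τ_le i)
  have hl := fun i => one_div_floor_le (B.κ_pos i) (B.κ_le i)
  rcases syncProb_cases B.n_pos B.d_pos B.κ_pos B.κ_le with hp | ⟨hp, hl1⟩
  · refine le_trans (by linarith [B.one_le]) (Finset.sum_le_sum (f := fun i =>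
      1 / eqDenom d ω σ ε (kappaMax κ) (h i) (τ i) (κ i) t) fun i _ => ?_)
    rw [← one_div]
    exact one_div_le_one_div_of_le (B.invWeight_pos i) (invWeight_le B.ω_nonneg B.ε_pos
      (syncProb_pos B.n_pos B.d_pos B.κ_pos B.κ_le) hkm (B.h_pos i) (B.τ_pos i) (B.κ_pos i)
      B.t_pos (hb i) (hm i) (hl i) hp)
  · refine (sum_one_div_affine_ge (fun i => eqDenom_pos B.ω_nonneg B.σ_pos B.ε_pos hkm (B.h_pos i)
      (B.τ_pos i) (B.κ_pos i) B.t_pos) B.one_le).trans (Finset.sum_le_sum fun i _ => ?_)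
    rw [← one_div]
    refine one_div_le_one_div_of_le (B.invWeight_pos i) ?_
    rw [budgetInvWeight, hp]
    refine invWeight_le_of_eq_one B.ω_nonneg B.ε_pos hkm (B.h_pos i) (B.τ_pos i) (B.κ_pos i)
      B.t_pos (hb i) (hm i) ?_
    rw [B.ω_eq]
    exact hl1 i

/-- The weights for the time budget `t`. -/
def budgetWeight (d : ℕ) (ω σ ε : ℝ) (h τ κ : Fin n → ℝ) (t : ℝ) : Fin n → ℝ :=
  optWeights ω ω σ ε (syncProb d κ t) (fun i => ⌊t / h i⌋₊) (fun i => ⌊t / τ i⌋₊)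
    fun i => ⌊t / κ i⌋₊

lemma budgetWeight_eq (i : Fin n) : budgetWeight d ω σ ε h τ κ t i =
    (budgetInvWeight d ω σ ε h τ κ t i)⁻¹ / ∑ j, (budgetInvWeight d ω σ ε h τ κ t j)⁻¹ := by
  unfold budgetWeight optWeights
  simp only [rawWeight_eq]
  rfl

lemma IsBudget.weight_nonneg (B : IsBudget d ω σ ε h τ κ t) (i : Fin n) :
    0 ≤ budgetWeight d ω σ ε h τ κ t i := by
  rw [budgetWeight_eq]
  exact div_nonneg (inv_nonneg.2 (B.invWeight_pos i).le) (by linarith [B.sum_weight_ge])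

lemma IsBudget.weight_sum (B : IsBudget d ω σ ε h τ κ t) :
    ∑ i, budgetWeight d ω σ ε h τ κ t i = 1 := by
  simp only [budgetWeight_eq]
  rw [← Finset.sum_div, div_self]
  linarith [B.sum_weight_ge]

/-- With `β i = w i / W` and `c i ≤ r / w i`, each term is at most `r * w i / W ^ 2`, so the sum is
at most `r / W`. -/
lemma IsBudget.sum_sq_weight_mul_le (B : IsBudget d ω σ ε h τ κ t) {c : Fin n → ℝ} {r : ℝ}
    (hr : 0 ≤ r) (hc : ∀ i, c i ≤ r * budgetInvWeight d ω σ ε h τ κ t i) :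
    ∑ i, budgetWeight d ω σ ε h τ κ t i ^ 2 * c i ≤ r * (17 / 8) := by
  have hW := B.sum_weight_ge
  set W := ∑ i, (budgetInvWeight d ω σ ε h τ κ t i)⁻¹ with hWdef
  have hW0 : 0 < W := by linarith
  calc ∑ i, budgetWeight d ω σ ε h τ κ t i ^ 2 * c i
      ≤ ∑ i, r / W ^ 2 * (budgetInvWeight d ω σ ε h τ κ t i)⁻¹ := by
        refine Finset.sum_le_sum fun i _ => ?_
        have hi := B.invWeight_pos i
        refine (mul_le_mul_of_nonneg_left (hc i) (sq_nonneg _)).trans (le_of_eq ?_)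
        rw [budgetWeight_eq, ← hWdef]
        field_simp
    _ = r * (1 / W) := by
        rw [← Finset.mul_sum, ← hWdef]
        field_simp
    _ ≤ r * (17 / 8) := by
        refine mul_le_mul_of_nonneg_left ?_ hr
        rw [div_le_div_iff₀ hW0 (by norm_num)]
        linarith

lemma IsBudget.floor_pos (B : IsBudget d ω σ ε h τ κ t) (i : Fin n) :
    0 < ⌊t / h i⌋₊ ∧ 0 < ⌊t / τ i⌋₊ ∧ 0 < ⌊t / κ i⌋₊ :=
  ⟨floor_pos_of_one_le ((one_le_div (B.h_pos i)).2 (B.h_le i)),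
    floor_pos_of_one_le ((one_le_div (B.τ_pos i)).2 (B.τ_le i)),
    floor_pos_of_one_le ((one_le_div (B.κ_pos i)).2 (B.κ_le i))⟩

/-- The effective smoothness constant for the time budget `t`. -/
def budgetSmoothness (d : ℕ) (ω σ ε Lm LA : ℝ) (h τ κ : Fin n → ℝ) (t : ℝ) : ℝ :=
  effSmoothness ω ω Lm LA (syncProb d κ t) (fun i => ⌊t / τ i⌋₊) (fun i => ⌊t / κ i⌋₊)
    (budgetWeight d ω σ ε h τ κ t)

variable {Lm LA : ℝ}

lemma IsBudget.admissible (B : IsBudget d ω σ ε h τ κ t) (hLm : 0 < Lm) (hLA : 0 ≤ LA) :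
    (budgetHyper d ω ω σ ε Lm LA h τ κ t).Admissible d Lm LA σ ε
      (budgetSmoothness d ω σ ε Lm LA h τ κ t) := by
  have hω := B.ω_nonneg
  have hε := B.ε_pos
  have hp := syncProb_pos B.n_pos B.d_pos B.κ_pos B.κ_le
  have hLmM : Lm ≤ budgetSmoothness d ω σ ε Lm LA h τ κ t := le_max_left _ _
  have hM := hLm.trans_le hLmM
  have hsq : ∀ {a x : ℝ}, 0 ≤ x → a * √x ≤ budgetSmoothness d ω σ ε Lm LA h τ κ t → 0 ≤ a * √x →
      a ^ 2 * x ≤ budgetSmoothness d ω σ ε Lm LA h τ κ t ^ 2 := by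
    intro a x hx h1 h2
    have := pow_le_pow_left₀ h2 h1 2
    rwa [mul_pow, Real.sq_sqrt hx] at this
  refine ⟨B.d_pos, fun i => (B.floor_pos i).1, fun i => (B.floor_pos i).2.1,
    fun i => (B.floor_pos i).2.2, hp, syncProb_le_one, B.weight_nonneg, B.weight_sum, hM, hLm.le,
    hLmM, rfl, ?_, ?_, ?_, ?_⟩
  · change LA ^ 2 * ∑ i, budgetWeight d ω σ ε h τ κ t i * (((d : ℝ) - 1) / ⌊t / κ i⌋₊) ≤
      syncProb d κ t * _
    rw [← B.ω_eq]
    have h1 := hsq (mul_nonneg (by positivity) (Finset.sum_nonneg fun i _ =>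
      div_nonneg (mul_nonneg hω (B.weight_nonneg i)) (Nat.cast_nonneg _)))
      ((le_max_right _ _).trans (le_max_right _ _)) (by positivity)
    refine le_trans (le_of_eq ?_) (mul_le_mul_of_nonneg_left h1 hp.le)
    rw [mul_left_comm, ← mul_assoc (syncProb d κ t), mul_one_div_cancel hp.ne', one_mul]
    congr 1
    exact Finset.sum_congr rfl fun i _ => by ring
  · change Lm ^ 2 * ∑ i, budgetWeight d ω σ ε h τ κ t i ^ 2 * (((d : ℝ) - 1) / ⌊t / κ i⌋₊ +
      ((d : ℝ) - 1) / ⌊t / τ i⌋₊ * (((d : ℝ) - 1) / ⌊t / κ i⌋₊)) ≤ syncProb d κ t * _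
    rw [← B.ω_eq]
    have h1 := hsq (Finset.sum_nonneg fun i _ => by positivity)
      ((le_max_left _ _).trans (le_max_right _ _)) (by positivity)
    refine le_trans (le_of_eq ?_) (mul_le_mul_of_nonneg_left h1 hp.le)
    rw [mul_left_comm, Finset.mul_sum _ _ (syncProb d κ t)]
    congr 1
    refine Finset.sum_congr rfl fun i _ => ?_
    obtain ⟨h1, h2, h3⟩ := B.floor_pos i
    field_simp
    ring
  · change ∑ i, budgetWeight d ω σ ε h τ κ t i ^ 2 * (((d : ℝ) - 1) / ⌊t / τ i⌋₊) ≤ _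
    rw [← B.ω_eq]
    refine (B.sum_sq_weight_mul_le (r := 1 / 8) (by norm_num) fun i => ?_).trans_eq (by norm_num)
    have : 0 ≤ 8 * (σ ^ 2 / ε) * ω * (1 / (⌊t / h i⌋₊ : ℝ)) * (1 / ⌊t / τ i⌋₊)
      + 8 * (σ ^ 2 / ε) * (1 / ⌊t / h i⌋₊)
      + ω ^ 2 * (1 / syncProb d κ t) * (1 / ⌊t / τ i⌋₊) * (1 / ⌊t / κ i⌋₊)
      + ω * (1 / syncProb d κ t) * (1 / ⌊t / κ i⌋₊) := by positivity
    rw [budgetInvWeight, invWeight, div_eq_mul_one_div]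
    linarith
  · change ∑ i, budgetWeight d ω σ ε h τ κ t i ^ 2 * (σ ^ 2 / ⌊t / h i⌋₊ +
      ((d : ℝ) - 1) / ⌊t / τ i⌋₊ * (σ ^ 2 / ⌊t / h i⌋₊)) ≤ _
    rw [← B.ω_eq]
    refine (B.sum_sq_weight_mul_le (r := ε / 8) (by positivity) fun i => ?_).trans_eq (by ring)
    have h0 : 0 ≤ ε / 8 * (8 * ω * (1 / (⌊t / τ i⌋₊ : ℝ))
      + ω ^ 2 * (1 / syncProb d κ t) * (1 / ⌊t / τ i⌋₊) * (1 / ⌊t / κ i⌋₊)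
      + ω * (1 / syncProb d κ t) * (1 / ⌊t / κ i⌋₊)) := by positivity
    have h1 : σ ^ 2 / ⌊t / h i⌋₊ + ω / ⌊t / τ i⌋₊ * (σ ^ 2 / ⌊t / h i⌋₊) =
        ε / 8 * (8 * (σ ^ 2 / ε) * ω * (1 / (⌊t / h i⌋₊ : ℝ)) * (1 / ⌊t / τ i⌋₊)
      + 8 * (σ ^ 2 / ε) * (1 / ⌊t / h i⌋₊)) := by
      obtain ⟨h1, h2, h3⟩ := B.floor_pos i
      field_simp
      ring
    rw [budgetInvWeight, invWeight, h1]
    linarith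

lemma IsBudget.smoothness_mul_le (B : IsBudget d ω σ ε h τ κ t) (hLm : 0 ≤ Lm) (hLA : 0 ≤ LA)
    (hLAm : LA ≤ Lm) : budgetSmoothness d ω σ ε Lm LA h τ κ t * t ≤
      2 * (t * Lm) + 2 * (d * kappaMax κ * LA) := by
  have ht := B.t_pos
  have hω := B.ω_nonneg
  have hkm := kappaMax_pos B.n_pos B.κ_pos
  have hp := syncProb_pos B.n_pos B.d_pos B.κ_pos B.κ_le
  have hd' : (0 : ℝ) < d := by exact_mod_cast B.d_pos
  set q := d * (2 * kappaMax κ / t) with hq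
  have hq0 : 0 ≤ q := by positivity
  have hqt : LA * q * t = 2 * (d * kappaMax κ * LA) := by
    rw [hq]
    field_simp
  have hnn : 0 ≤ 2 * (d * kappaMax κ * LA) := by positivity
  -- The second entry of the maximum is at most `Lm * √(17/8) ≤ 2 * Lm`. The third is at most `LA *
  -- q` if `p` is the rounded ratio, and at most `LA ≤ Lm` if `p = 1`.
  suffices hM : budgetSmoothness d ω σ ε Lm LA h τ κ t ≤ 2 * Lm + LA * q by
    have := mul_le_mul_of_nonneg_right hM ht.le
    linarith
  have hLq : 0 ≤ LA * q := by positivity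
  refine max_le (by linarith) (max_le ?_ ?_)
  · have h1 : √(∑ i, (ω * ω / (syncProb d κ t * ⌊t / τ i⌋₊ * ⌊t / κ i⌋₊) +
        ω / (syncProb d κ t * ⌊t / κ i⌋₊)) * budgetWeight d ω σ ε h τ κ t i ^ 2) ≤ 2 := by
      rw [Real.sqrt_le_left (by norm_num)]
      simp only [mul_comm _ (budgetWeight d ω σ ε h τ κ t _ ^ 2)]
      refine (B.sum_sq_weight_mul_le (r := 1) (by norm_num) fun i => ?_).trans (by norm_num)
      have h0 : 0 ≤ 8 * ω * (1 / (⌊t / τ i⌋₊ : ℝ)) +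
        8 * (σ ^ 2 / ε) * ω * (1 / (⌊t / h i⌋₊ : ℝ)) * (1 / ⌊t / τ i⌋₊)
        + 8 * (σ ^ 2 / ε) * (1 / ⌊t / h i⌋₊) := by
        have := B.ε_pos
        positivity
      have h1 : ω * ω / (syncProb d κ t * ⌊t / τ i⌋₊ * ⌊t / κ i⌋₊) +
        ω / (syncProb d κ t * ⌊t / κ i⌋₊) =
        ω ^ 2 * (1 / syncProb d κ t) * (1 / ⌊t / τ i⌋₊) * (1 / ⌊t / κ i⌋₊)
        + ω * (1 / syncProb d κ t) * (1 / ⌊t / κ i⌋₊) := by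
        obtain ⟨h1, h2, h3⟩ := B.floor_pos i
        field_simp
      rw [h1, budgetInvWeight, invWeight]
      linarith
    have := mul_le_mul_of_nonneg_left h1 hLm
    linarith
  · have h1 : ∀ {r : ℝ}, 0 ≤ r →
        (∀ i, 1 / syncProb d κ t * (ω * (1 / (⌊t / κ i⌋₊ : ℝ))) ≤ r ^ 2) →
        √(1 / syncProb d κ t * ∑ i, ω * budgetWeight d ω σ ε h τ κ t i / ⌊t / κ i⌋₊) ≤ r := by
      intro r hr hle
      rw [Real.sqrt_le_left hr]
      calc 1 / syncProb d κ t * ∑ i, ω * budgetWeight d ω σ ε h τ κ t i / ⌊t / κ i⌋₊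
          ≤ ∑ i, r ^ 2 * budgetWeight d ω σ ε h τ κ t i := by
            rw [Finset.mul_sum]
            refine Finset.sum_le_sum fun i _ => le_trans (le_of_eq ?_)
              (mul_le_mul_of_nonneg_right (hle i) (B.weight_nonneg i))
            ring
        _ = r ^ 2 := by rw [← Finset.mul_sum, B.weight_sum, mul_one]
    rcases syncProb_cases B.n_pos B.d_pos B.κ_pos B.κ_le with hp1 | ⟨hp1, hl1⟩
    · have := mul_le_mul_of_nonneg_left (h1 hq0 fun i => ?_) hLA
      · linarith
      · have hl : ω * (1 / (⌊t / κ i⌋₊ : ℝ)) ≤ q := by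
          have h2 := one_div_floor_le (B.κ_pos i) (B.κ_le i)
          have h3 := le_kappaMax κ i
          calc ω * (1 / (⌊t / κ i⌋₊ : ℝ)) ≤ d * (2 * κ i / t) := by
                have : ω ≤ d := by linarith [B.ω_eq]
                gcongr
            _ ≤ q := by
                rw [hq]
                gcongr
        rw [sq]
        gcongr
    · have := mul_le_mul_of_nonneg_left (h1 zero_le_one fun i => ?_) hLA
      · linarith
      · rw [hp1, B.ω_eq]
        simpa using hl1 i

end Budget

end Inkheart

end

/-! ### The complexity theorem -/

theorem mainTheorem5 :
    ∃ C : ℝ, 0 < C ∧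
      ∀ (n d : ℕ), 0 < n → 0 < d →
      ∀ (h τ κ : Fin n → ℝ), (∀ i, 0 < h i) → (∀ i, 0 < τ i) → (∀ i, 0 < κ i) →
      ∀ (σ ε : ℝ), 0 < σ → 0 < ε →
      ∀ (ω ωs : ℝ), ω = (d : ℝ) - 1 → ωs = (d : ℝ) - 1 →
      (∃! s : ℝ, Inkheart.IsEquilibriumTime d ω ωs σ ε h τ κ s) ∧
      ∀ s : ℝ, Inkheart.IsEquilibriumTime d ω ωs σ ε h τ κ s →
      ∀ (f : Inkheart.Vec d → ℝ) (x0 : Inkheart.Vec d) (L LA LB fstar Lmax Δ t : ℝ),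
        Inkheart.IsLSmooth f L → (∀ x, fstar ≤ f x) → Inkheart.FunctionalAB f LA LB →
        Lmax = max L (max LA LB) → Δ = f x0 - fstar → t = Inkheart.timeBudget h τ κ s →
      ∀ (Ξ : Type*) [MeasurableSpace Ξ] (D : MeasureTheory.Measure Ξ)
        [MeasureTheory.IsProbabilityMeasure D] (G : Inkheart.Vec d → Ξ → Inkheart.Vec d),
        Inkheart.IsStochasticGradient f G D σ →
      ∀ (H : Inkheart.Hyper n), H = Inkheart.budgetHyper d ω ωs σ ε Lmax LA h τ κ t →
      ∀ (Ω : Type*) [MeasurableSpace Ω] (P : MeasureTheory.Measure Ω)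
        [MeasureTheory.IsProbabilityMeasure P] (ζ : ℕ → Ω → Inkheart.Noise H d Ξ),
        Inkheart.IsNoiseSequence H D P ζ →
      ∀ (T : Inkheart.Durations h τ κ Ω) (N : ℕ),
        N = Inkheart.numIterations H ω ωs Lmax LA Δ ε →
        Inkheart.IsStationaryPoint f ε
            (P.prod (ProbabilityTheory.uniformOn (Set.univ : Set (Fin (N + 1)))))
            (Inkheart.output H G x0 ζ N) ∧
          MeasureTheory.Integrable (Inkheart.totalTime H T ζ N) P ∧
          ∫ a, Inkheart.totalTime H T ζ N a ∂P ≤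
            C * (t * Lmax * Δ / ε + d * Inkheart.kappaMax κ * LA * Δ / ε) := by
  -- `384 = 48 * 4 * 2`: the iteration count, the time `4t` per iteration, and the factor 2 in the
  -- bound for `M t`.
  refine ⟨384, by norm_num, ?_⟩
  intro n d hn hd h τ κ hh hτ hκ σ ε hσ hε ω ωs hω hωs
  obtain rfl : ωs = ω := hωs.trans hω.symm
  have hω0 : 0 ≤ ωs := by
    have : (1 : ℝ) ≤ d := by exact_mod_cast hd
    linarith
  refine ⟨Inkheart.existsUnique_isEquilibriumTime hn hω0 hσ hε hh hτ hκ, ?_⟩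
  intro s hs f x0 L LA LB fstar Lmax Δ t hf hfs hAB hLmax hΔ ht Ξ _ D _ G hG H hH Ω _ P _ ζ hζ T N
    hN
  have B := Inkheart.isBudget_timeBudget hn hd hω hσ hε hh hτ hκ hs
  rw [← ht] at B
  have hLA : LA ≤ Lmax := hLmax ▸ (le_max_left _ _).trans (le_max_right _ _)
  have hLB : LB ≤ Lmax := hLmax ▸ (le_max_right _ _).trans (le_max_right _ _)
  have hL : L ≤ Lmax := hLmax ▸ le_max_left _ _
  have hLA0 := hAB.1
  have hLm0 : 0 ≤ Lmax := hLA0.trans hLA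
  have hΔ0 : 0 ≤ Δ := by linarith [hfs x0]
  subst hH
  set M := Inkheart.budgetSmoothness d ωs σ ε Lmax LA h τ κ t with hM
  have hN' : N = ⌊48 * (Δ / ε) * M⌋₊ := hN
  have hM0 : 0 ≤ M := hLm0.trans (le_max_left _ _)
  have ht0 := B.t_pos
  refine ⟨?_, ?_⟩
  · rcases hLm0.lt_or_eq with hpos | hzero
    · refine Inkheart.isStationaryPoint_output (B.admissible hpos hLA0) hLB hε hG (hf.mono hL) hAB
        hfs hζ ?_
      rw [← hΔ, hN', ← hM]
      -- Rounding `N` down is harmless because the output is drawn from `N + 1` points.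
      exact (Nat.lt_floor_add_one _).le
    · rw [← hzero] at hL
      exact Inkheart.isStationaryPoint_of_gradient_eq_zero hG.1 hζ.1 hε.le
        (fun x => (hf.mono hL).gradient_eq_zero hfs x) N
  · have hp := Inkheart.syncProb_pos hn hd hκ B.κ_le
    obtain ⟨hint, hle⟩ := Inkheart.integral_totalTime_le hn hd hp.le
      Inkheart.syncProb_le_one hζ T (t := t)
      (fun i => Inkheart.floor_mul_le (hh i) ht0.le)
      (fun i => Inkheart.floor_mul_le (hτ i) ht0.le)
      (fun i => Inkheart.floor_mul_le (hκ i) ht0.le) ht0.le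
      (Inkheart.kappaMax_pos hn hκ).le (Inkheart.syncProb_mul_le hn hd hκ ht0.le) N
    refine ⟨hint, hle.trans ?_⟩
    have h1 : (N : ℝ) ≤ 48 * (Δ / ε) * M := hN' ▸ Nat.floor_le (by positivity)
    calc (N : ℝ) * (4 * t) ≤ 48 * (Δ / ε) * M * (4 * t) := by gcongr
      _ = 192 * (Δ / ε) * (M * t) := by ring
      _ ≤ 192 * (Δ / ε) * (2 * (t * Lmax) + 2 * (d * Inkheart.kappaMax κ * LA)) := by
        have := B.smoothness_mul_le hLm0 hLA0 hLA
        gcongr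
      _ = _ := by ring
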